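/- Let $X_1,X_2,\dots$ be independent (not necessarily identically distributed) real random variables on a probability space with $\mathbb E[X_k]=0$ and $\mathrm{Var}(X_k)=1$ for all $k\ge 1$. Assume that each $X_k$ has a density $p_k$ supported on an interval of $\mathbb R$ (positive on the interval, zero outside it) and differentiable in the interior of that interval. Let $$\tau_k(x)=\frac{\int_x^\infty y\,p_k(y)\,dy}{p_k(x)}$$ for $x$ in the support of $p_k$ be the Stein kernel of $X_k$. Put $S_n=(X_1+\dots+X_n)/\sqrt n$. Assume that $$\beta:=\max\Big\{\sup_{k\ge1}\mathbb E|X_k|^8,\ \sup_{k\ge1}\mathbb E|\tau_k(X_k)|^8,\ \sup_{k\ge1}\mathbb E|\tau_k'(X_k)|^8\Big\}<\infty$$ and that $\mathbb E|\tau_1(X_1)+\dots+\tau_{n_0}(X_{n_0})|^{-8}<\infty$ for some $n_0\ge 1$. Then $$\gamma:=\sup_{n\ge n_0} n^8\,\mathbb E|\tau_1(X_1)+\dots+\tau_n(X_n)|^{-8}<\infty ,$$ and for every $n\ge n_0$ the law of $S_n$ has an absolutely continuous density and $$I(S_n\|Z)\le \frac{C_{\beta,\gamma}}{n},$$ where $C_{\beta,\gamma}$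 is a positive constant depending only on $\beta$ and $\gamma$. Here $Z\sim N(0,1)$ and, for a random variable $F$ with mean $0$, variance $1$ and absolutely continuous density $p_F$, $I(F\|Z):=\mathbb E\big[(\rho_F(F)+F)^2\big]$ with score function $\rho_F=p_F'/p_F$. -/

import Mathlib

open MeasureTheory ProbabilityTheory
open scoped ENNReal

noncomputable section

/-- The law `ν` has the density `p` with respect to Lebesgue measure; the density is supported on
an interval (it vanishes off an interval and is positive on it), and it is differentiable inside
that interval. Nothing is required at the end points, so that, for instance, the uniform and the
exponential densities are covered. -/
structure HasIntervalDensity (ν : Measure ℝ) (p : ℝ → ℝ) : Prop where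
  nonneg : ∀ x, 0 ≤ p x
  ordConnected : (Function.support p).OrdConnected
  differentiableOn : DifferentiableOn ℝ p (interior (Function.support p))
  law_eq : ν = volume.withDensity (fun x => ENNReal.ofReal (p x))

/-- The Stein kernel `τ(x) = (∫_x^∞ (y - m) p(y) dy) / p(x)` of the density `p`, where
`m = ∫ z p(z) dz` is its mean. It is only meaningful for `x` in the support of `p`. -/
def steinKernel (p : ℝ → ℝ) (x : ℝ) : ℝ :=
  (∫ y in Set.Ioi x, (y - ∫ z, z * p z) * p y) / p x

/-- The law `ν` has the (locally) absolutely continuous density `p`, and `p'` is a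
Radon-Nikodym derivative of `p`. -/
structure HasACDensity (ν : Measure ℝ) (p p' : ℝ → ℝ) : Prop where
  nonneg : ∀ x, 0 ≤ p x
  law_eq : ν = volume.withDensity (fun x => ENNReal.ofReal (p x))
  locallyIntegrable : LocallyIntegrable p' volume
  integral_eq : ∀ a b : ℝ, ∫ x in a..b, p' x = p b - p a

/-- The Fisher information distance `I(F‖Z) = E[(ρ_F(F) + F)²]`, `Z ∼ N(0,1)`, of a law `ν` with
mean `0` and variance `1`, where `ρ_F = p_F' / p_F` is the score function of `F ∼ ν`. The pair
`(p_F, p_F')` is essentially unique if it exists, and then the infimum is the value at that pair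
(`fisherDistance_eq`); the infimum is `∞` if `ν` has no absolutely continuous density. -/
def fisherDistance (ν : Measure ℝ) : ℝ≥0∞ :=
  ⨅ (p : ℝ → ℝ) (p' : ℝ → ℝ) (_ : HasACDensity ν p p'),
    ∫⁻ x, ENNReal.ofReal ((p' x / p x + x) ^ 2) ∂ν

theorem HasACDensity.continuous {ν : Measure ℝ} {p p' : ℝ → ℝ} (h : HasACDensity ν p p') :
    Continuous p := by
  have h1 : p = fun b => p 0 + ∫ x in (0 : ℝ)..b, p' x := by
    funext b
    rw [h.integral_eq]
    ring
  rw [h1]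
  exact continuous_const.add (intervalIntegral.continuous_primitive
    (fun a b => (h.locallyIntegrable.integrableOn_isCompact isCompact_uIcc).intervalIntegrable) 0)

theorem HasACDensity.eq_density {ν : Measure ℝ} [IsFiniteMeasure ν] {p p' q q' : ℝ → ℝ}
    (hp : HasACDensity ν p p') (hq : HasACDensity ν q q') : p = q := by
  have h1 : (fun x => ENNReal.ofReal (p x)) =ᵐ[volume] fun x => ENNReal.ofReal (q x) := by
    refine (withDensity_eq_iff (by have := hp.continuous; fun_prop)
      (by have := hq.continuous; fun_prop) ?_).1 (hp.law_eq.symm.trans hq.law_eq)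
    rw [← setLIntegral_univ, ← withDensity_apply _ MeasurableSet.univ, ← hp.law_eq]
    exact measure_ne_top _ _
  refine (hp.continuous.ae_eq_iff_eq volume hq.continuous).1 ?_
  filter_upwards [h1] with x hx
  exact (ENNReal.ofReal_eq_ofReal_iff (hp.nonneg x) (hq.nonneg x)).1 hx

theorem HasACDensity.ae_hasDerivAt {ν : Measure ℝ} {p p' : ℝ → ℝ} (h : HasACDensity ν p p') :
    ∀ᵐ x, HasDerivAt p (p' x) x := by
  filter_upwards [_root_.LocallyIntegrable.ae_hasDerivAt_integral h.locallyIntegrable] with x hx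
  have h1 : p = fun b => p 0 + ∫ y in (0 : ℝ)..b, p' y := by
    funext b
    rw [h.integral_eq]
    ring
  rw [h1]
  exact (hx 0).const_add _

/-- The value of `fisherDistance` may be computed from any choice of the density and of its
Radon-Nikodym derivative. -/
theorem fisherDistance_eq {ν : Measure ℝ} [IsFiniteMeasure ν] {p p' : ℝ → ℝ}
    (h : HasACDensity ν p p') :
    fisherDistance ν = ∫⁻ x, ENNReal.ofReal ((p' x / p x + x) ^ 2) ∂ν := by
  refine le_antisymm (iInf_le_of_le p (iInf_le_of_le p' (iInf_le _ h))) ?_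
  refine le_iInf fun q => le_iInf fun q' => le_iInf fun hq => le_of_eq ?_
  have hpq := h.eq_density hq
  subst hpq
  refine lintegral_congr_ae ?_
  have hν : ν ≪ volume := by
    rw [h.law_eq]
    exact withDensity_absolutelyContinuous _ _
  filter_upwards [hν.ae_le h.ae_hasDerivAt, hν.ae_le hq.ae_hasDerivAt] with x h1 h2
  rw [h1.unique h2]

/-- `β = max {sup_k E|X_k|⁸, sup_k E|τ_k(X_k)|⁸, sup_k E|τ_k'(X_k)|⁸}`, where `p k` is the density
of `X k` and `τ_k` its Stein kernel. -/
def momentBound {Ω : Type*} [MeasurableSpace Ω] (P : Measure Ω) (X : ℕ → Ω → ℝ)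
    (p : ℕ → ℝ → ℝ) : ℝ≥0∞ :=
  max (⨆ k, ∫⁻ ω, ‖X k ω‖ₑ ^ 8 ∂P)
    (max (⨆ k, ∫⁻ ω, ‖steinKernel (p k) (X k ω)‖ₑ ^ 8 ∂P)
      (⨆ k, ∫⁻ ω, ‖deriv (steinKernel (p k)) (X k ω)‖ₑ ^ 8 ∂P))

/-- `E|τ_1(X_1) + ⋯ + τ_n(X_n)|^{-8}`, with `0^{-8} = ∞`. The sequence `X_1, X_2, …` is indexed
as `X 0, X 1, …`. -/
def negMoment {Ω : Type*} [MeasurableSpace Ω] (P : Measure Ω) (X : ℕ → Ω → ℝ)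
    (p : ℕ → ℝ → ℝ) (n : ℕ) : ℝ≥0∞ :=
  ∫⁻ ω, (‖∑ k ∈ Finset.range n, steinKernel (p k) (X k ω)‖ₑ ^ 8)⁻¹ ∂P

/-- `γ = sup_{n ≥ n₀} n⁸ E|τ_1(X_1) + ⋯ + τ_n(X_n)|^{-8}`. -/
def negMomentSup {Ω : Type*} [MeasurableSpace Ω] (P : Measure Ω) (X : ℕ → Ω → ℝ)
    (p : ℕ → ℝ → ℝ) (n₀ : ℕ) : ℝ≥0∞ :=
  ⨆ n ≥ n₀, (n : ℝ≥0∞) ^ 8 * negMoment P X p n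

end

open Set Filter Topology CompactlySupported

theorem Set.OrdConnected.countable_frontier {s : Set ℝ} (hs : s.OrdConnected) :
    (frontier s).Countable := by
  refine Set.Countable.mono (s₂ := {sInf s, sSup s}) ?_ (by simp)
  have h := hs.isPreconnected.mem_intervals
  generalize sInf s = a at h
  generalize sSup s = b at h
  have hcl : ∀ t : Set ℝ, Ioo a b ⊆ t → t ⊆ Icc a b → frontier t ⊆ {a, b} := by
    intro t h1 h2 x hx
    have hx1 : x ∈ Icc a b := isClosed_Icc.closure_subset_iff.2 h2 hx.1
    have hx2 : x ∉ Ioo a b := fun h3 => hx.2 (interior_maximal h1 isOpen_Ioo h3)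
    rcases eq_or_lt_of_le hx1.1 with h | h
    · left; exact h.symm
    · rcases eq_or_lt_of_le hx1.2 with h' | h'
      · right; exact h'
      · exact absurd ⟨h, h'⟩ hx2
  simp only [mem_insert_iff, mem_singleton_iff] at h
  rcases h with h | h | h | h | h | h | h | h | h | h <;> rw [h]
  · exact hcl _ Ioo_subset_Icc_self le_rfl
  · exact hcl _ Ioo_subset_Ico_self Ico_subset_Icc_self
  · exact hcl _ Ioo_subset_Ioc_self Ioc_subset_Icc_self
  · exact hcl _ le_rfl Ioo_subset_Icc_self
  all_goals simp

namespace HasIntervalDensity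

variable {ν : Measure ℝ} {p : ℝ → ℝ}

theorem continuousOn (h : HasIntervalDensity ν p) :
    ContinuousOn p (interior (Function.support p)) :=
  h.differentiableOn.continuousOn

theorem measurable (h : HasIntervalDensity ν p) : Measurable p := by
  have hm : Measurable ((interior (Function.support p)).indicator p) := by
    classical
    rw [← Set.piecewise_eq_indicator]
    exact h.continuousOn.measurable_piecewise continuousOn_const
      isOpen_interior.measurableSet
  refine hm.measurable_of_countable_ne (h.ordConnected.countable_frontier.mono ?_)
  intro x hx
  by_cases hxi : x ∈ interior (Function.support p)
  · exact absurd (Set.indicator_of_mem hxi p) hx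
  · refine ⟨subset_closure ?_, hxi⟩
    intro h0
    exact hx (by rw [Set.indicator_of_notMem hxi, h0])

theorem integral_eq (h : HasIntervalDensity ν p) (g : ℝ → ℝ) :
    ∫ x, g x ∂ν = ∫ x, g x * p x := by
  rw [h.law_eq, integral_withDensity_eq_integral_toReal_smul h.measurable.ennreal_ofReal (by simp)]
  refine integral_congr_ae (ae_of_all _ fun x => ?_)
  simp [ENNReal.toReal_ofReal (h.nonneg x), mul_comm]

theorem integrable_iff (h : HasIntervalDensity ν p) (g : ℝ → ℝ) :
    Integrable g ν ↔ Integrable fun x => g x * p x := by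
  rw [h.law_eq, integrable_withDensity_iff_integrable_smul' h.measurable.ennreal_ofReal (by simp)]
  refine integrable_congr (ae_of_all _ fun x => ?_)
  simp [ENNReal.toReal_ofReal (h.nonneg x), mul_comm]

end HasIntervalDensity

/-- The numerator `∫_x^∞ y p(y) dy` of the Stein kernel of a centred density. -/
noncomputable def upperMean (p : ℝ → ℝ) (x : ℝ) : ℝ := ∫ y in Ioi x, y * p y

section

variable {ν : Measure ℝ} {p : ℝ → ℝ}

theorem upperMean_eq_zero_of_le {x : ℝ} (hx : ∀ y, x < y → p y = 0) : upperMean p x = 0 := by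
  refine setIntegral_eq_zero_of_forall_eq_zero fun y hy => ?_
  rw [hx y hy, mul_zero]

theorem upperMean_eq_neg (hp : Integrable fun x => x * p x) (hm : ∫ x, x * p x = 0) (x : ℝ) :
    upperMean p x = - ∫ y in Iic x, y * p y := by
  have h := integral_add_compl (measurableSet_Ioi (a := x)) hp
  rw [compl_Ioi, hm] at h
  unfold upperMean
  linarith

theorem upperMean_eq_zero (h : HasIntervalDensity ν p) (hp : Integrable fun x => x * p x)
    (hm : ∫ x, x * p x = 0) {x : ℝ} (hx : p x = 0) : upperMean p x = 0 := by
  by_cases h1 : ∃ y, x < y ∧ p y ≠ 0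
  · obtain ⟨y, hxy, hy⟩ := h1
    rw [upperMean_eq_neg hp hm, neg_eq_zero]
    refine setIntegral_eq_zero_of_forall_eq_zero fun z hz => ?_
    by_cases hpz : p z = 0
    · rw [hpz, mul_zero]
    · exact absurd hx (h.ordConnected.out hpz hy ⟨hz, hxy.le⟩)
  · push Not at h1
    exact upperMean_eq_zero_of_le h1

theorem upperMean_nonneg (h : HasIntervalDensity ν p) (hp : Integrable fun x => x * p x)
    (hm : ∫ x, x * p x = 0) (x : ℝ) : 0 ≤ upperMean p x := by
  rcases le_total 0 x with hx | hx
  · exact setIntegral_nonneg measurableSet_Ioi fun y hy =>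
      mul_nonneg (hx.trans (le_of_lt hy)) (h.nonneg y)
  · rw [upperMean_eq_neg hp hm, neg_nonneg]
    exact setIntegral_nonpos measurableSet_Iic fun y hy =>
      mul_nonpos_of_nonpos_of_nonneg (le_trans hy hx) (h.nonneg y)

theorem upperMean_eq_sub (hp : Integrable fun x => x * p x) (x : ℝ) :
    upperMean p x = upperMean p 0 - ∫ y in (0 : ℝ)..x, y * p y := by
  have h := intervalIntegral.integral_Ioi_sub_Ioi' (μ := volume) (a := 0) (b := x)
    (hp.integrableOn (s := Ioi 0)) (hp.integrableOn (s := Ioi x))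
  unfold upperMean
  linarith

theorem continuous_upperMean (hp : Integrable fun x => x * p x) : Continuous (upperMean p) := by
  rw [funext (upperMean_eq_sub hp)]
  exact continuous_const.sub (intervalIntegral.continuous_primitive
    (fun a b => hp.intervalIntegrable) 0)

theorem hasDerivAt_upperMean (h : HasIntervalDensity ν p) (hp : Integrable fun x => x * p x)
    {x : ℝ} (hx : x ∈ interior (Function.support p)) :
    HasDerivAt (upperMean p) (-(x * p x)) x := by
  rw [funext (upperMean_eq_sub hp)]
  refine (intervalIntegral.integral_hasDerivAt_right hp.intervalIntegrable
    ?_ ?_).const_sub _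
  · exact (measurable_id.mul h.measurable).stronglyMeasurable.stronglyMeasurableAtFilter
  · exact continuousAt_id.mul (h.continuousOn.continuousAt (isOpen_interior.mem_nhds hx))

/-- The tail bound `(1 + |x|) ∫_x^∞ y p(y) dy → 0` at `+∞`. -/
theorem tendsto_upperMean_atTop (h : HasIntervalDensity ν p) (hp : Integrable fun x => x * p x)
    (hp2 : Integrable fun x => x ^ 2 * p x) (hm : ∫ x, x * p x = 0) :
    Tendsto (fun x => (1 + |x|) * upperMean p x) atTop (𝓝 0) := by
  have h2 : Tendsto (fun x : ℝ => ∫ y in Ioi x, (|y * p y| + y ^ 2 * p y)) atTop (𝓝 0) := by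
    have := tendsto_setIntegral_of_antitone (μ := volume)
      (f := fun y => |y * p y| + y ^ 2 * p y) (s := fun x : ℝ => Ioi x)
      (fun _ => measurableSet_Ioi) (fun a b hab => Ioi_subset_Ioi hab)
      ⟨0, (hp.abs.add hp2).integrableOn⟩
    have he : ⋂ x : ℝ, Ioi x = ∅ := by
      ext y; simp only [mem_iInter, mem_Ioi, mem_empty_iff_false, iff_false, not_forall]
      exact ⟨y, lt_irrefl y⟩
    rwa [he, setIntegral_empty] at this
  refine squeeze_zero' (Eventually.of_forall fun x =>
    mul_nonneg (by positivity) (upperMean_nonneg h hp hm x)) ?_ h2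
  filter_upwards [eventually_ge_atTop 0] with x hx
  unfold upperMean
  rw [← integral_const_mul]
  refine setIntegral_mono_on (hp.integrableOn.const_mul _) (hp.abs.add hp2).integrableOn
    measurableSet_Ioi fun y hy => ?_
  have hxy : x < y := hy
  have h3 := h.nonneg y
  have h4 := le_abs_self (y * p y)
  rw [abs_of_nonneg hx]
  have h5 : x * (y * p y) ≤ y * (y * p y) :=
    mul_le_mul_of_nonneg_right hxy.le (mul_nonneg (hx.trans hxy.le) h3)
  nlinarith

theorem HasIntervalDensity.comp_neg (h : HasIntervalDensity ν p) :
    HasIntervalDensity (ν.map Neg.neg) fun x => p (-x) := by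
  have hs : Function.support (fun x => p (-x)) = Neg.neg ⁻¹' Function.support p := rfl
  have hi : interior (Function.support fun x => p (-x)) =
      Neg.neg ⁻¹' interior (Function.support p) := by
    rw [hs]; exact ((Homeomorph.neg ℝ).preimage_interior _).symm
  refine ⟨fun x => h.nonneg _, ?_, ?_, ?_⟩
  · rw [hs]
    exact ⟨fun x hx y hy z hz => h.ordConnected.out hy hx
      ⟨neg_le_neg hz.2, neg_le_neg hz.1⟩⟩
  · rw [hi]
    exact h.differentiableOn.comp (differentiableOn_neg _) fun x hx => hx
  · refine Measure.ext fun s hs => ?_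
    rw [Measure.map_apply measurable_neg hs, h.law_eq,
      withDensity_apply _ (measurable_neg hs), withDensity_apply _ hs]
    have := (Measure.measurePreserving_neg (volume : Measure ℝ)).setLIntegral_comp_preimage hs
      (f := fun x => ENNReal.ofReal (p (-x))) (h.measurable.comp measurable_neg).ennreal_ofReal
    simpa using this

theorem tendsto_upperMean_atBot (h : HasIntervalDensity ν p) (hp : Integrable fun x => x * p x)
    (hp2 : Integrable fun x => x ^ 2 * p x) (hm : ∫ x, x * p x = 0) :
    Tendsto (fun x => (1 + |x|) * upperMean p x) atBot (𝓝 0) := by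
  have hq : Integrable fun x => x * p (-x) := by
    have := hp.comp_neg.neg
    refine this.congr (ae_of_all _ fun x => by simp)
  have hq2 : Integrable fun x => x ^ 2 * p (-x) := by
    refine hp2.comp_neg.congr (ae_of_all _ fun x => by simp)
  have hqm : ∫ x, x * p (-x) = 0 := by
    have h1 := integral_neg_eq_self (fun x => x * p x) volume
    simp only [neg_mul, integral_neg] at h1
    linarith
  have h1 := (tendsto_upperMean_atTop h.comp_neg hq hq2 hqm).comp tendsto_neg_atBot_atTop
  refine h1.congr fun x => ?_
  simp only [Function.comp, abs_neg]
  congr 1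
  rw [upperMean_eq_neg hp hm, upperMean, ← integral_neg, ← integral_comp_neg_Iic]
  simp

/-- **Stein's identity** for the kernel of a centred interval density. -/
theorem integral_mul_eq_integral_upperMean (h : HasIntervalDensity ν p)
    (hp : Integrable fun x => x * p x) (hp2 : Integrable fun x => x ^ 2 * p x)
    (hm : ∫ x, x * p x = 0) {f f' : ℝ → ℝ} {M : ℝ}
    (hf : ∀ x ∈ interior (Function.support p), HasDerivAt f (f' x) x)
    (hfM : ∀ x, |f x| ≤ M * (1 + |x|)) (hfm : Measurable f)
    (hf' : Integrable fun x => upperMean p x * f' x) :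
    ∫ x, x * f x * p x = ∫ x, upperMean p x * f' x := by
  set G : ℝ → ℝ := fun x => upperMean p x * f x with hG
  set D : ℝ → ℝ := fun x => upperMean p x * f' x - x * f x * p x with hD
  have hGb : ∀ x, |G x| ≤ M * ((1 + |x|) * upperMean p x) := by
    intro x
    rw [hG, abs_mul, abs_of_nonneg (upperMean_nonneg h hp hm x)]
    nlinarith [mul_le_mul_of_nonneg_left (hfM x) (upperMean_nonneg h hp hm x)]
  have hcH := continuous_upperMean hp
  have hGc : Continuous G := by
    rw [continuous_iff_continuousAt]
    intro x
    by_cases hx : x ∈ interior (Function.support p)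
    · exact hcH.continuousAt.mul (hf x hx).continuousAt
    · by_cases hx0 : upperMean p x = 0
      · have h0 : G x = 0 := by simp [hG, hx0]
        rw [ContinuousAt, h0]
        refine squeeze_zero_norm hGb ?_
        have : Continuous fun x => M * ((1 + |x|) * upperMean p x) := by fun_prop
        have := this.tendsto x
        simpa [hx0] using this
      · exfalso
        have hn : {y | upperMean p y ≠ 0} ⊆ Function.support p :=
          fun y hy hpy => hy (upperMean_eq_zero h hp hm hpy)
        exact hx (interior_maximal hn (isOpen_ne.preimage hcH) hx0)
  have hGd : ∀ x ∉ frontier (Function.support p), HasDerivAt G (D x) x := by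
    intro x hx
    by_cases hxi : x ∈ interior (Function.support p)
    · refine ((hasDerivAt_upperMean h hp hxi).mul (hf x hxi)).congr_deriv ?_
      simp only [hD]; ring
    · have hxc : x ∈ (closure (Function.support p))ᶜ := fun hc => hx ⟨hc, hxi⟩
      have hz : ∀ y ∈ (closure (Function.support p))ᶜ, p y = 0 := fun y hy => by
        by_contra h0; exact hy (subset_closure h0)
      have h0 : D x = 0 := by
        simp [hD, hz x hxc, upperMean_eq_zero h hp hm (hz x hxc)]
      rw [h0]
      refine (hasDerivAt_const x (0 : ℝ)).congr_of_eventuallyEq ?_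
      filter_upwards [isClosed_closure.isOpen_compl.mem_nhds hxc] with y hy
      simp [hG, upperMean_eq_zero h hp hm (hz y hy)]
  have hxf : Integrable fun x => x * f x * p x := by
    refine ((hp.abs.add hp2).const_mul M).mono'
      ((measurable_id.mul hfm).mul h.measurable).aestronglyMeasurable (ae_of_all _ fun x => ?_)
    have h3 := h.nonneg x
    rw [Real.norm_eq_abs, abs_mul, abs_mul, abs_of_nonneg h3]
    simp only [Pi.add_apply, abs_mul, abs_of_nonneg h3]
    have h4 := mul_le_mul_of_nonneg_left (hfM x) (mul_nonneg (abs_nonneg x) h3)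
    rw [← sq_abs x]
    linarith
  have hDi : Integrable D := hf'.sub hxf
  have key : ∀ R : ℝ, ∫ x in (-R)..R, D x = G R - G (-R) := fun R =>
    integral_eq_of_hasDerivAt_off_countable G D h.ordConnected.countable_frontier
      hGc.continuousOn (fun x hx => hGd x hx.2) hDi.intervalIntegrable
  have hlim1 := intervalIntegral_tendsto_integral hDi tendsto_neg_atTop_atBot tendsto_id
  have hlim2 : Tendsto (fun R => G R - G (-R)) atTop (𝓝 0) := by
    have ht : Tendsto G atTop (𝓝 0) := squeeze_zero_norm hGb (by
      simpa using (tendsto_upperMean_atTop h hp hp2 hm).const_mul M)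
    have hb : Tendsto G atBot (𝓝 0) := squeeze_zero_norm hGb (by
      simpa using (tendsto_upperMean_atBot h hp hp2 hm).const_mul M)
    simpa using ht.sub (hb.comp tendsto_neg_atTop_atBot)
  have h0 : ∫ x, D x = 0 := by
    refine tendsto_nhds_unique hlim1 (hlim2.congr fun R => ?_)
    exact (key R).symm
  rw [hD, integral_sub hf' hxf] at h0
  linarith

end

namespace HasIntervalDensity

variable {ν : Measure ℝ} {p : ℝ → ℝ}

theorem steinKernel_eq (h : HasIntervalDensity ν p) (hm : ∫ x, x ∂ν = 0) (x : ℝ) :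
    steinKernel p x = upperMean p x / p x := by
  rw [h.integral_eq] at hm
  simp [steinKernel, upperMean, hm]

theorem steinKernel_mul (h : HasIntervalDensity ν p) (h1 : Integrable (fun x => x) ν)
    (hm : ∫ x, x ∂ν = 0) (x : ℝ) : steinKernel p x * p x = upperMean p x := by
  rw [h.steinKernel_eq hm]
  by_cases hx : p x = 0
  · rw [hx, mul_zero, upperMean_eq_zero h ((h.integrable_iff _).1 h1)
      ((h.integral_eq _).symm.trans hm) hx]
  · field_simp

theorem steinKernel_nonneg (h : HasIntervalDensity ν p) (h1 : Integrable (fun x => x) ν)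
    (hm : ∫ x, x ∂ν = 0) (x : ℝ) : 0 ≤ steinKernel p x := by
  rw [h.steinKernel_eq hm]
  exact div_nonneg (upperMean_nonneg h ((h.integrable_iff _).1 h1)
      ((h.integral_eq _).symm.trans hm) x) (h.nonneg x)

theorem measurable_steinKernel (h : HasIntervalDensity ν p) (h1 : Integrable (fun x => x) ν)
    (hm : ∫ x, x ∂ν = 0) : Measurable (steinKernel p) := by
  rw [funext (h.steinKernel_eq hm)]
  exact (continuous_upperMean ((h.integrable_iff _).1 h1)).measurable.div h.measurable

theorem hasDerivAt_steinKernel (h : HasIntervalDensity ν p) (h1 : Integrable (fun x => x) ν)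
    (hm : ∫ x, x ∂ν = 0) {x : ℝ} (hx : x ∈ interior (Function.support p)) :
    HasDerivAt (steinKernel p) (deriv (steinKernel p) x) x := by
  refine DifferentiableAt.hasDerivAt ?_
  rw [funext (h.steinKernel_eq hm)]
  exact (hasDerivAt_upperMean h ((h.integrable_iff _).1 h1) hx).differentiableAt.div
    (h.differentiableOn.differentiableAt (isOpen_interior.mem_nhds hx)) (interior_subset hx)

/-- **Stein's identity** `E[X f(X)] = E[τ(X) f'(X)]`. -/
theorem stein_identity (h : HasIntervalDensity ν p) (h1 : Integrable (fun x => x) ν)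
    (h2 : Integrable (fun x => x ^ 2) ν) (hm : ∫ x, x ∂ν = 0) {f f' : ℝ → ℝ} {M : ℝ}
    (hf : ∀ x ∈ interior (Function.support p), HasDerivAt f (f' x) x)
    (hfM : ∀ x, |f x| ≤ M * (1 + |x|)) (hfm : Measurable f)
    (hf' : Integrable (fun x => steinKernel p x * f' x) ν) :
    ∫ x, x * f x ∂ν = ∫ x, steinKernel p x * f' x ∂ν := by
  have he : ∀ x, steinKernel p x * f' x * p x = upperMean p x * f' x := fun x => by
    rw [mul_right_comm, h.steinKernel_mul h1 hm]
  rw [h.integrable_iff] at hf'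
  simp only [he] at hf'
  rw [h.integral_eq, h.integral_eq]
  simp only [he]
  exact integral_mul_eq_integral_upperMean h ((h.integrable_iff _).1 h1)
    ((h.integrable_iff _).1 h2) ((h.integral_eq _).symm.trans hm) hf hfM hfm hf'

theorem integral_steinKernel (h : HasIntervalDensity ν p) (h1 : Integrable (fun x => x) ν)
    (h2 : Integrable (fun x => x ^ 2) ν) (hm : ∫ x, x ∂ν = 0)
    (hτ : Integrable (steinKernel p) ν) : ∫ x, steinKernel p x ∂ν = ∫ x, x ^ 2 ∂ν := by
  have := h.stein_identity h1 h2 hm (f := fun x => x) (f' := fun _ => 1) (M := 1)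
    (fun x _ => hasDerivAt_id x) (fun x => by linarith) measurable_id (by simpa using hτ)
  simpa [pow_two] using this.symm

end HasIntervalDensity

theorem HasIntervalDensity.stein_identity_shift {ν : Measure ℝ} [IsFiniteMeasure ν] {p : ℝ → ℝ}
    (h : HasIntervalDensity ν p)
    (h1 : Integrable (fun x => x) ν) (h2 : Integrable (fun x => x ^ 2) ν) (hm : ∫ x, x ∂ν = 0)
    (hτ' : Integrable (deriv (steinKernel p)) ν) {φ φ' : ℝ → ℝ} {M c ε s t : ℝ}
    (hφ : ∀ x, HasDerivAt φ (φ' x) x) (hφ'c : Continuous φ') (hφM : ∀ x, |φ x| ≤ M)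
    (hφ'M : ∀ x, |φ' x| ≤ M) (hc : 0 ≤ c) (hε : 0 < ε) (ht : 0 ≤ t) :
    ∫ x, x * (φ (c * (x + s)) / (steinKernel p x + t + ε)) ∂ν =
      ∫ x, steinKernel p x * (c * φ' (c * (x + s)) / (steinKernel p x + t + ε) -
        φ (c * (x + s)) * deriv (steinKernel p) x / (steinKernel p x + t + ε) ^ 2) ∂ν := by
  have hτ := h.steinKernel_nonneg h1 hm
  have hτm := h.measurable_steinKernel h1 hm
  have hφc : Continuous φ := continuous_iff_continuousAt.2 fun x => (hφ x).continuousAt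
  have hpos : ∀ x, 0 < steinKernel p x + t + ε := fun x => by have := hτ x; positivity
  have hM : 0 ≤ M := (abs_nonneg _).trans (hφM 0)
  have hφm := hφc.measurable
  have hφ'm := hφ'c.measurable
  have hdm := measurable_deriv (steinKernel p)
  refine h.stein_identity h1 h2 hm (M := M / ε) ?_ ?_ ?_ ?_
  · intro x hx
    have hin : HasDerivAt (fun x : ℝ => c * (x + s)) c x := by
      simpa using ((hasDerivAt_id x).add_const s).const_mul c
    have ha := (hφ (c * (x + s))).comp x hin
    have hb := ((h.hasDerivAt_steinKernel h1 hm hx).add_const t).add_const ε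
    refine (ha.div hb (hpos x).ne').congr_deriv ?_
    have := (hpos x).ne'
    simp only [Function.comp]
    field_simp
  · intro x
    rw [abs_div, abs_of_pos (hpos x)]
    calc |φ (c * (x + s))| / (steinKernel p x + t + ε) ≤ M / ε := by
          gcongr
          · exact hφM _
          · have := hτ x; linarith
      _ ≤ M / ε * (1 + |x|) :=
          le_mul_of_one_le_right (by positivity) (by linarith [abs_nonneg x])
  · exact Measurable.div (by fun_prop) (by fun_prop)
  · refine ((integrable_const (c * M)).add (hτ'.abs.const_mul (M / ε))).mono'
      (Measurable.aestronglyMeasurable ?_) (ae_of_all _ fun x => ?_)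
    · refine hτm.mul (Measurable.sub (Measurable.div (by fun_prop) (by fun_prop))
        (Measurable.div (by fun_prop) (by fun_prop)))
    · have hD := hpos x
      have hτx := hτ x
      have hr : steinKernel p x / (steinKernel p x + t + ε) ≤ 1 := by
        rw [div_le_one hD]; linarith
      have hr0 : 0 ≤ steinKernel p x / (steinKernel p x + t + ε) := by positivity
      have hr2 : 1 / (steinKernel p x + t + ε) ≤ 1 / ε := by
        gcongr; linarith
      have e : steinKernel p x * (c * φ' (c * (x + s)) / (steinKernel p x + t + ε) -
        φ (c * (x + s)) * deriv (steinKernel p) x / (steinKernel p x + t + ε) ^ 2) =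
        (steinKernel p x / (steinKernel p x + t + ε)) * (c * φ' (c * (x + s))) -
        (steinKernel p x / (steinKernel p x + t + ε)) * (1 / (steinKernel p x + t + ε)) *
          (φ (c * (x + s)) * deriv (steinKernel p) x) := by
        field_simp
      rw [e]
      refine (norm_sub_le _ _).trans ?_
      simp only [Real.norm_eq_abs, abs_mul, Pi.add_apply]
      rw [abs_of_nonneg hr0, abs_of_nonneg hc,
        abs_of_nonneg (by positivity : (0:ℝ) ≤ 1 / (steinKernel p x + t + ε))]
      refine add_le_add ?_ ?_
      · calc _ ≤ 1 * (c * M) := by gcongr; exact hφ'M _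
          _ = c * M := one_mul _
      · calc _ ≤ 1 * (1 / ε) * (M * |deriv (steinKernel p) x|) := by
              gcongr; exact hφM _
          _ = _ := by ring

/-- Independent centred square-integrable random variables with interval densities, such that the
derivatives of the Stein kernels are integrable. -/
structure SteinSystem {Ω : Type*} [MeasurableSpace Ω] (P : Measure Ω) (X : ℕ → Ω → ℝ)
    (p : ℕ → ℝ → ℝ) : Prop where
  measurable : ∀ k, Measurable (X k)
  indep : iIndepFun X P
  dens : ∀ k, HasIntervalDensity (P.map (X k)) (p k)
  integrable : ∀ k, Integrable (X k) P
  integrable_sq : ∀ k, Integrable (fun ω => X k ω ^ 2) P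
  mean : ∀ k, ∫ ω, X k ω ∂P = 0
  integrable_deriv : ∀ k, Integrable (fun ω => deriv (steinKernel (p k)) (X k ω)) P

namespace SteinSystem

variable {Ω : Type*} [MeasurableSpace Ω] {P : Measure Ω}
  {X : ℕ → Ω → ℝ} {p : ℕ → ℝ → ℝ}

theorem map_integrable (h : SteinSystem P X p) (k : ℕ) :
    Integrable (fun x => x) (P.map (X k)) :=
  (integrable_map_measure (by fun_prop) (h.measurable k).aemeasurable).2 (h.integrable k)

theorem map_integrable_sq (h : SteinSystem P X p) (k : ℕ) :
    Integrable (fun x => x ^ 2) (P.map (X k)) :=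
  (integrable_map_measure (by fun_prop) (h.measurable k).aemeasurable).2 (h.integrable_sq k)

theorem map_mean (h : SteinSystem P X p) (k : ℕ) : ∫ x, x ∂(P.map (X k)) = 0 := by
  rw [integral_map (h.measurable k).aemeasurable (by fun_prop)]
  exact h.mean k

theorem map_integrable_deriv (h : SteinSystem P X p) (k : ℕ) :
    Integrable (deriv (steinKernel (p k))) (P.map (X k)) :=
  (integrable_map_measure (measurable_deriv _).aestronglyMeasurable
    (h.measurable k).aemeasurable).2 (h.integrable_deriv k)

theorem measurable_deriv_kernel (h : SteinSystem P X p) (k : ℕ) :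
    Measurable (fun ω => deriv (steinKernel (p k)) (X k ω)) :=
  (measurable_deriv _).comp (h.measurable k)

theorem measurable_sum (h : SteinSystem P X p) (s : Finset ℕ) :
    Measurable (fun ω => ∑ k ∈ s, X k ω) :=
  Finset.measurable_fun_sum _ fun k _ => h.measurable k

theorem steinKernel_nonneg (h : SteinSystem P X p) (k : ℕ) (x : ℝ) : 0 ≤ steinKernel (p k) x :=
  (h.dens k).steinKernel_nonneg (h.map_integrable k) (h.map_mean k) x

theorem measurable_steinKernel (h : SteinSystem P X p) (k : ℕ) : Measurable (steinKernel (p k)) :=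
  (h.dens k).measurable_steinKernel (h.map_integrable k) (h.map_mean k)

theorem measurable_kernel (h : SteinSystem P X p) (k : ℕ) :
    Measurable (fun ω => steinKernel (p k) (X k ω)) :=
  (h.measurable_steinKernel k).comp (h.measurable k)

theorem measurable_kernel_sum (h : SteinSystem P X p) (s : Finset ℕ) :
    Measurable (fun ω => ∑ k ∈ s, steinKernel (p k) (X k ω)) :=
  Finset.measurable_fun_sum _ fun k _ => h.measurable_kernel k

theorem measurable_kernel_deriv_sum (h : SteinSystem P X p) (s : Finset ℕ) :
    Measurable (fun ω =>
      ∑ k ∈ s, steinKernel (p k) (X k ω) * deriv (steinKernel (p k)) (X k ω)) :=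
  Finset.measurable_fun_sum _ fun k _ => (h.measurable_kernel k).mul (h.measurable_deriv_kernel k)

theorem kernel_sum_nonneg (h : SteinSystem P X p) (s : Finset ℕ) (ω : Ω) :
    0 ≤ ∑ k ∈ s, steinKernel (p k) (X k ω) :=
  Finset.sum_nonneg fun k _ => h.steinKernel_nonneg k _

theorem indepFun_pair (h : SteinSystem P X p) {k : ℕ} {s : Finset ℕ} (hk : k ∉ s) :
    IndepFun (X k) (fun ω => (∑ j ∈ s, X j ω, ∑ j ∈ s, steinKernel (p j) (X j ω))) P := by
  have h0 := h.indep.indepFun_finset {k} s (by simpa using hk) h.measurable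
  have m1 : Measurable fun x : ({k} : Finset ℕ) → ℝ => x ⟨k, Finset.mem_singleton_self k⟩ :=
    measurable_pi_apply _
  have m2 : Measurable fun x : s → ℝ =>
      (∑ j, x j, ∑ j : s, steinKernel (p j) (x j)) :=
    (Finset.measurable_fun_sum _ fun j _ => measurable_pi_apply j).prodMk
      (Finset.measurable_fun_sum _ fun j _ =>
        (h.measurable_steinKernel j).comp (measurable_pi_apply j))
  have := h0.comp m1 m2
  refine this.congr (ae_of_all _ fun ω => rfl) (ae_of_all _ fun ω => ?_)
  simp only [Function.comp]
  rw [Finset.sum_coe_sort s (fun j => X j ω),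
    Finset.sum_coe_sort s (fun j => steinKernel (p j) (X j ω))]

variable {φ φ' : ℝ → ℝ} {M c ε : ℝ}

theorem integrable_mul_div (h : SteinSystem P X p) (s : Finset ℕ) (k : ℕ) (hφc : Continuous φ)
    (hφM : ∀ x, |φ x| ≤ M) (hε : 0 < ε) :
    Integrable (fun ω => X k ω * (φ (c * ∑ j ∈ s, X j ω) /
      (∑ j ∈ s, steinKernel (p j) (X j ω) + ε))) P := by
  have := h.measurable_sum s
  have := h.measurable_kernel_sum s
  have hφm := hφc.measurable
  refine (h.integrable k).mul_bdd (c := M / ε) ?_ (ae_of_all _ fun ω => ?_)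
  · exact (Measurable.div (by fun_prop) (by fun_prop)).aestronglyMeasurable
  · have hT := h.kernel_sum_nonneg s ω
    have hM : 0 ≤ M := (abs_nonneg _).trans (hφM 0)
    rw [norm_div, Real.norm_eq_abs, Real.norm_eq_abs,
      abs_of_pos (by positivity : 0 < ∑ j ∈ s, steinKernel (p j) (X j ω) + ε)]
    gcongr
    · exact hφM _
    · linarith

variable [IsProbabilityMeasure P]

theorem integrable_kernel_mul (h : SteinSystem P X p) {s : Finset ℕ} {k : ℕ} (hk : k ∈ s)
    (hφc : Continuous φ) (hφ'c : Continuous φ')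
    (hφM : ∀ x, |φ x| ≤ M) (hφ'M : ∀ x, |φ' x| ≤ M) (hc : 0 ≤ c) (hε : 0 < ε) :
    Integrable (fun ω => steinKernel (p k) (X k ω) *
      (c * φ' (c * ∑ j ∈ s, X j ω) / (∑ j ∈ s, steinKernel (p j) (X j ω) + ε) -
        φ (c * ∑ j ∈ s, X j ω) * deriv (steinKernel (p k)) (X k ω) /
          (∑ j ∈ s, steinKernel (p j) (X j ω) + ε) ^ 2)) P := by
  have := h.measurable_sum s
  have := h.measurable_kernel_sum s
  have := h.measurable_kernel k
  have := h.measurable_deriv_kernel k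
  have hφm := hφc.measurable
  have hφ'm := hφ'c.measurable
  refine ((integrable_const (c * M)).add ((h.integrable_deriv k).abs.const_mul (M / ε))).mono'
    (Measurable.aestronglyMeasurable ?_) (ae_of_all _ fun ω => ?_)
  · exact Measurable.mul (by fun_prop) (Measurable.sub (Measurable.div (by fun_prop) (by fun_prop))
      (Measurable.div (by fun_prop) (by fun_prop)))
  · have hT := h.kernel_sum_nonneg s ω
    have hτx := h.steinKernel_nonneg k (X k ω)
    have hle : steinKernel (p k) (X k ω) ≤ ∑ j ∈ s, steinKernel (p j) (X j ω) :=
      Finset.single_le_sum (f := fun j => steinKernel (p j) (X j ω))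
        (fun j _ => h.steinKernel_nonneg j _) hk
    change _ ≤ c * M + M / ε * |deriv (steinKernel (p k)) (X k ω)|
    generalize (∑ j ∈ s, steinKernel (p j) (X j ω)) = T at *
    generalize (∑ j ∈ s, X j ω) = S at *
    generalize deriv (steinKernel (p k)) (X k ω) = d
    generalize steinKernel (p k) (X k ω) = τ at *
    have hM : 0 ≤ M := (abs_nonneg _).trans (hφM 0)
    have hD : 0 < T + ε := by positivity
    have hr : τ / (T + ε) ≤ 1 := by rw [div_le_one hD]; linarith
    have hr0 : 0 ≤ τ / (T + ε) := by positivity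
    have hr2 : 1 / (T + ε) ≤ 1 / ε := by gcongr; linarith
    have e : τ * (c * φ' (c * S) / (T + ε) - φ (c * S) * d / (T + ε) ^ 2) =
        (τ / (T + ε)) * (c * φ' (c * S)) - (τ / (T + ε)) * (1 / (T + ε)) * (φ (c * S) * d) := by
      field_simp
    rw [e]
    refine (norm_sub_le _ _).trans ?_
    simp only [Real.norm_eq_abs, abs_mul]
    rw [abs_of_nonneg hr0, abs_of_nonneg hc, abs_of_nonneg (by positivity : (0:ℝ) ≤ 1 / (T + ε))]
    refine add_le_add ?_ ?_
    · calc _ ≤ 1 * (c * M) := by gcongr; exact hφ'M _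
        _ = c * M := one_mul _
    · calc _ ≤ 1 * (1 / ε) * (M * |d|) := by gcongr; exact hφM _
        _ = _ := by ring

theorem integral_mul_div (h : SteinSystem P X p) {s : Finset ℕ} {k : ℕ} (hk : k ∈ s)
    (hφ : ∀ x, HasDerivAt φ (φ' x) x) (hφ'c : Continuous φ')
    (hφM : ∀ x, |φ x| ≤ M) (hφ'M : ∀ x, |φ' x| ≤ M) (hc : 0 ≤ c) (hε : 0 < ε) :
    ∫ ω, X k ω * (φ (c * ∑ j ∈ s, X j ω) / (∑ j ∈ s, steinKernel (p j) (X j ω) + ε)) ∂P =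
    ∫ ω, steinKernel (p k) (X k ω) *
      (c * φ' (c * ∑ j ∈ s, X j ω) / (∑ j ∈ s, steinKernel (p j) (X j ω) + ε) -
        φ (c * ∑ j ∈ s, X j ω) * deriv (steinKernel (p k)) (X k ω) /
          (∑ j ∈ s, steinKernel (p j) (X j ω) + ε) ^ 2) ∂P := by
  have hφc : Continuous φ := continuous_iff_continuousAt.2 fun x => (hφ x).continuousAt
  have hφm := hφc.measurable
  have hφ'm := hφ'c.measurable
  have i1 := h.integrable_mul_div s k (c := c) hφc hφM hε
  have i2 := h.integrable_kernel_mul hk hφc hφ'c hφM hφ'M hc hε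
  set Y : Ω → ℝ × ℝ := fun ω => (∑ j ∈ s.erase k, X j ω,
    ∑ j ∈ s.erase k, steinKernel (p j) (X j ω)) with hY
  have hYm : Measurable Y := (h.measurable_sum _).prodMk (h.measurable_kernel_sum _)
  have hind : IndepFun (X k) Y P := h.indepFun_pair (Finset.notMem_erase k s)
  have hmap := (indepFun_iff_map_prod_eq_prod_map_map (h.measurable k).aemeasurable
    hYm.aemeasurable).1 hind
  have hXY : Measurable fun ω => (X k ω, Y ω) := (h.measurable k).prodMk hYm
  set F : ℝ × (ℝ × ℝ) → ℝ := fun z => z.1 * (φ (c * (z.1 + z.2.1)) /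
    (steinKernel (p k) z.1 + z.2.2 + ε)) with hF
  set K : ℝ × (ℝ × ℝ) → ℝ := fun z => steinKernel (p k) z.1 *
    (c * φ' (c * (z.1 + z.2.1)) / (steinKernel (p k) z.1 + z.2.2 + ε) -
      φ (c * (z.1 + z.2.1)) * deriv (steinKernel (p k)) z.1 /
        (steinKernel (p k) z.1 + z.2.2 + ε) ^ 2) with hK
  have m1 : Measurable fun z : ℝ × (ℝ × ℝ) => steinKernel (p k) z.1 :=
    (h.measurable_steinKernel k).comp measurable_fst
  have m2 : Measurable fun z : ℝ × (ℝ × ℝ) => deriv (steinKernel (p k)) z.1 :=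
    (measurable_deriv _).comp measurable_fst
  have hFm : Measurable F := Measurable.mul (by fun_prop) (Measurable.div (by fun_prop) (by fun_prop))
  have hKm : Measurable K := Measurable.mul (by fun_prop)
    (Measurable.sub (Measurable.div (by fun_prop) (by fun_prop))
      (Measurable.div (by fun_prop) (by fun_prop)))
  have e1 : ∀ ω, ∑ j ∈ s, X j ω = X k ω + (Y ω).1 := fun ω =>
    (Finset.add_sum_erase s (fun j => X j ω) hk).symm
  have e2 : ∀ ω, ∑ j ∈ s, steinKernel (p j) (X j ω) = steinKernel (p k) (X k ω) + (Y ω).2 :=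
    fun ω => (Finset.add_sum_erase s (fun j => steinKernel (p j) (X j ω)) hk).symm
  simp only [e1, e2] at i1 i2 ⊢
  change Integrable (fun ω => F (X k ω, Y ω)) P at i1
  change Integrable (fun ω => K (X k ω, Y ω)) P at i2
  change ∫ ω, F (X k ω, Y ω) ∂P = ∫ ω, K (X k ω, Y ω) ∂P
  rw [← integral_map hXY.aemeasurable hFm.aestronglyMeasurable,
    ← integral_map hXY.aemeasurable hKm.aestronglyMeasurable]
  have j1 := (integrable_map_measure hFm.aestronglyMeasurable hXY.aemeasurable).2 i1
  have j2 := (integrable_map_measure hKm.aestronglyMeasurable hXY.aemeasurable).2 i2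
  rw [hmap] at j1 j2 ⊢
  have : IsProbabilityMeasure (P.map (X k)) :=
    Measure.isProbabilityMeasure_map (h.measurable k).aemeasurable
  have : IsProbabilityMeasure (P.map Y) := Measure.isProbabilityMeasure_map hYm.aemeasurable
  rw [integral_prod_symm _ j1, integral_prod_symm _ j2]
  refine integral_congr_ae ?_
  have hY0 : ∀ᵐ y ∂(P.map Y), 0 ≤ y.2 := by
    rw [ae_map_iff hYm.aemeasurable (measurableSet_le measurable_const measurable_snd)]
    exact ae_of_all _ fun ω => h.kernel_sum_nonneg _ ω
  filter_upwards [hY0] with y hy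
  exact (h.dens k).stein_identity_shift (h.map_integrable k) (h.map_integrable_sq k)
    (h.map_mean k) (h.map_integrable_deriv k) (s := y.1) hφ hφ'c hφM hφ'M hc hε hy

theorem integral_sum_mul_div (h : SteinSystem P X p) (s : Finset ℕ)
    (hφ : ∀ x, HasDerivAt φ (φ' x) x) (hφ'c : Continuous φ')
    (hφM : ∀ x, |φ x| ≤ M) (hφ'M : ∀ x, |φ' x| ≤ M) (hc : 0 ≤ c) (hε : 0 < ε) :
    ∫ ω, (∑ j ∈ s, X j ω) *
      (φ (c * ∑ j ∈ s, X j ω) / (∑ j ∈ s, steinKernel (p j) (X j ω) + ε)) ∂P =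
    ∫ ω, ((∑ j ∈ s, steinKernel (p j) (X j ω)) * (c * φ' (c * ∑ j ∈ s, X j ω)) /
        (∑ j ∈ s, steinKernel (p j) (X j ω) + ε) -
      φ (c * ∑ j ∈ s, X j ω) *
        (∑ k ∈ s, steinKernel (p k) (X k ω) * deriv (steinKernel (p k)) (X k ω)) /
          (∑ j ∈ s, steinKernel (p j) (X j ω) + ε) ^ 2) ∂P := by
  have hφc : Continuous φ := continuous_iff_continuousAt.2 fun x => (hφ x).continuousAt
  have h1 := Finset.sum_congr (rfl : s = s) fun k hk =>
    h.integral_mul_div hk hφ hφ'c hφM hφ'M hc hε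
  rw [← integral_finsetSum _ fun k _ => h.integrable_mul_div s k hφc hφM hε,
    ← integral_finsetSum _ fun k hk => h.integrable_kernel_mul hk hφc hφ'c hφM hφ'M hc hε] at h1
  convert h1 using 2
  · funext ω
    rw [Finset.sum_mul]
  · funext ω
    simp only [mul_sub, Finset.sum_sub_distrib]
    congr 1
    · rw [mul_div_assoc, Finset.sum_mul]
    · rw [Finset.mul_sum, Finset.sum_div]
      exact Finset.sum_congr rfl fun k _ => by ring

/-- The integration by parts formula
`c E[φ'(c S)] = E[φ(c S) (S / T + R / T²)]`, with `S = ∑ X_k`, `T = ∑ τ_k(X_k)` and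
`R = ∑ τ_k(X_k) τ_k'(X_k)`. -/
theorem integral_deriv_eq (h : SteinSystem P X p) (s : Finset ℕ)
    (hT : ∀ᵐ ω ∂P, ∑ j ∈ s, steinKernel (p j) (X j ω) ≠ 0)
    (hST : Integrable (fun ω => (∑ j ∈ s, X j ω) / ∑ j ∈ s, steinKernel (p j) (X j ω)) P)
    (hRT : Integrable (fun ω =>
      (∑ k ∈ s, steinKernel (p k) (X k ω) * deriv (steinKernel (p k)) (X k ω)) /
        (∑ j ∈ s, steinKernel (p j) (X j ω)) ^ 2) P)
    (hφ : ∀ x, HasDerivAt φ (φ' x) x) (hφ'c : Continuous φ')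
    (hφM : ∀ x, |φ x| ≤ M) (hφ'M : ∀ x, |φ' x| ≤ M) (hc : 0 ≤ c) :
    c * ∫ ω, φ' (c * ∑ j ∈ s, X j ω) ∂P =
      ∫ ω, φ (c * ∑ j ∈ s, X j ω) *
        ((∑ j ∈ s, X j ω) / (∑ j ∈ s, steinKernel (p j) (X j ω)) +
        (∑ k ∈ s, steinKernel (p k) (X k ω) * deriv (steinKernel (p k)) (X k ω)) /
        (∑ j ∈ s, steinKernel (p j) (X j ω)) ^ 2) ∂P := by
  have hφc : Continuous φ := continuous_iff_continuousAt.2 fun x => (hφ x).continuousAt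
  have hφm := hφc.measurable
  have hφ'm := hφ'c.measurable
  have hM : 0 ≤ M := (abs_nonneg _).trans (hφM 0)
  have hT0 := h.kernel_sum_nonneg s
  have mS := h.measurable_sum s
  have mT := h.measurable_kernel_sum s
  have mR := h.measurable_kernel_deriv_sum s
  have key := fun m : ℕ => h.integral_sum_mul_div s hφ hφ'c hφM hφ'M hc
    (Nat.one_div_pos_of_nat (α := ℝ) (n := m))
  set S : Ω → ℝ := fun ω => ∑ j ∈ s, X j ω with hS
  set T : Ω → ℝ := fun ω => ∑ j ∈ s, steinKernel (p j) (X j ω) with hTdef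
  set R : Ω → ℝ := fun ω =>
    ∑ k ∈ s, steinKernel (p k) (X k ω) * deriv (steinKernel (p k)) (X k ω) with hR
  change c * ∫ ω, φ' (c * S ω) ∂P = ∫ ω, φ (c * S ω) * (S ω / T ω + R ω / T ω ^ 2) ∂P
  change Integrable (fun ω => S ω / T ω) P at hST
  change Integrable (fun ω => R ω / T ω ^ 2) P at hRT
  change ∀ m : ℕ, ∫ ω, S ω * (φ (c * S ω) / (T ω + 1 / ((m : ℝ) + 1))) ∂P =
    ∫ ω, (T ω * (c * φ' (c * S ω)) / (T ω + 1 / ((m : ℝ) + 1)) -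
      φ (c * S ω) * R ω / (T ω + 1 / ((m : ℝ) + 1)) ^ 2) ∂P at key
  have hlim : ∀ ω, Tendsto (fun m : ℕ => T ω + 1 / ((m : ℝ) + 1)) atTop (𝓝 (T ω)) := fun ω => by
    simpa using tendsto_const_nhds.add (tendsto_one_div_add_atTop_nhds_zero_nat (𝕜 := ℝ))
  have hge : ∀ ω (m : ℕ), T ω ≤ T ω + 1 / ((m : ℝ) + 1) := fun ω m =>
    le_add_of_nonneg_right (by positivity)
  have L1 : Tendsto (fun m : ℕ => ∫ ω, S ω * (φ (c * S ω) / (T ω + 1 / ((m : ℝ) + 1))) ∂P) atTop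
      (𝓝 (∫ ω, S ω * (φ (c * S ω) / T ω) ∂P)) := by
    refine tendsto_integral_of_dominated_convergence (fun ω => M * |S ω / T ω|)
      (fun m => Measurable.aestronglyMeasurable ?_) (hST.abs.const_mul M) (fun m => ?_) ?_
    · exact Measurable.mul (by fun_prop) (Measurable.div (by fun_prop) (by fun_prop))
    · filter_upwards [hT] with ω hω
      have hpos : 0 < T ω := lt_of_le_of_ne (hT0 ω) (Ne.symm hω)
      have := hge ω m
      rw [norm_mul, norm_div, abs_div, Real.norm_eq_abs, Real.norm_eq_abs, Real.norm_eq_abs,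
        abs_of_pos hpos, abs_of_pos (hpos.trans_le this)]
      calc |S ω| * (|φ (c * S ω)| / (T ω + 1 / ((m : ℝ) + 1))) ≤ |S ω| * (M / T ω) := by
            gcongr; exact hφM _
        _ = _ := by ring
    · filter_upwards [hT] with ω hω
      exact ((tendsto_const_nhds.div (hlim ω) hω)).const_mul _
  have L2 : Tendsto (fun m : ℕ => ∫ ω, (T ω * (c * φ' (c * S ω)) / (T ω + 1 / ((m : ℝ) + 1)) -
      φ (c * S ω) * R ω / (T ω + 1 / ((m : ℝ) + 1)) ^ 2) ∂P) atTop
      (𝓝 (∫ ω, (T ω * (c * φ' (c * S ω)) / T ω - φ (c * S ω) * R ω / T ω ^ 2) ∂P)) := by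
    refine tendsto_integral_of_dominated_convergence (fun ω => c * M + M * |R ω / T ω ^ 2|)
      (fun m => Measurable.aestronglyMeasurable ?_)
      ((integrable_const _).add (hRT.abs.const_mul M)) (fun m => ?_) ?_
    · exact Measurable.sub (Measurable.div (by fun_prop) (by fun_prop))
        (Measurable.div (by fun_prop) (by fun_prop))
    · filter_upwards [hT] with ω hω
      have hpos : 0 < T ω := lt_of_le_of_ne (hT0 ω) (Ne.symm hω)
      have hg := hge ω m
      have hD := hpos.trans_le hg
      refine (norm_sub_le _ _).trans (add_le_add ?_ ?_)
      · rw [mul_div_right_comm, norm_mul, norm_mul]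
        simp only [Real.norm_eq_abs]
        rw [abs_of_nonneg hc, abs_of_nonneg (by positivity)]
        calc _ ≤ 1 * (c * M) := by
              gcongr
              · exact (div_le_one hD).2 hg
              · exact hφ'M _
          _ = _ := one_mul _
      · rw [norm_div, norm_mul, abs_div]
        simp only [Real.norm_eq_abs, abs_pow]
        rw [abs_of_pos hpos, abs_of_pos hD]
        calc _ ≤ M * |R ω| / T ω ^ 2 := by gcongr; exact hφM _
          _ = _ := by ring
    · filter_upwards [hT] with ω hω
      exact (tendsto_const_nhds.div (hlim ω) hω).sub
        (tendsto_const_nhds.div ((hlim ω).pow 2) (pow_ne_zero _ hω))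
  have h1 := tendsto_nhds_unique L1 (L2.congr fun m => (key m).symm)
  have hb : ∀ᵐ ω ∂P, ‖φ (c * S ω)‖ ≤ M := ae_of_all _ fun ω => hφM _
  have m1 : AEStronglyMeasurable (fun ω => φ (c * S ω)) P :=
    (hφm.comp (mS.const_mul c)).aestronglyMeasurable
  have m2 : AEStronglyMeasurable (fun ω => φ' (c * S ω)) P :=
    (hφ'm.comp (mS.const_mul c)).aestronglyMeasurable
  have i1 : Integrable (fun ω => c * φ' (c * S ω)) P :=
    (Integrable.of_bound m2 M (ae_of_all _ fun ω => hφ'M _)).const_mul c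
  have i2 := hRT.bdd_mul m1 hb
  have i3 := hST.bdd_mul m1 hb
  have e2 : ∫ ω, (T ω * (c * φ' (c * S ω)) / T ω - φ (c * S ω) * R ω / T ω ^ 2) ∂P =
      ∫ ω, (c * φ' (c * S ω) - φ (c * S ω) * (R ω / T ω ^ 2)) ∂P := by
    refine integral_congr_ae ?_
    filter_upwards [hT] with ω hω
    have : T ω ≠ 0 := hω
    field_simp
  have e1 : ∫ ω, S ω * (φ (c * S ω) / T ω) ∂P = ∫ ω, φ (c * S ω) * (S ω / T ω) ∂P := by
    congr 1; funext ω; ring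
  rw [e1, e2, integral_sub i1 i2, integral_const_mul] at h1
  simp only [mul_add]
  rw [integral_add i3 i2, h1]
  ring

end SteinSystem

theorem measurable_setIntegral_Ioi {μ : Measure ℝ} [SFinite μ] {w : ℝ → ℝ} (hw : Measurable w) :
    Measurable fun x => ∫ t in Ioi x, w t ∂μ := by
  have h1 : (fun x => ∫ t in Ioi x, w t ∂μ) =
      fun x => ∫ t, {z : ℝ × ℝ | z.1 < z.2}.indicator (fun z => w z.2) (x, t) ∂μ := by
    funext x
    rw [← integral_indicator measurableSet_Ioi]
    rfl
  rw [h1]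
  exact ((hw.comp measurable_snd).indicator
    (measurableSet_lt measurable_fst measurable_snd)).stronglyMeasurable.integral_prod_right'.measurable

theorem integral_setIntegral_Iio_mul {μ : Measure ℝ} [SFinite μ] {w ψ : ℝ → ℝ}
    (hw : Integrable w μ) (hψ : Integrable ψ) :
    ∫ s, (∫ x in Iio s, ψ x) * w s ∂μ = ∫ x, ψ x * ∫ s in Ioi x, w s ∂μ := by
  have hi : Integrable (fun z : ℝ × ℝ => {z : ℝ × ℝ | z.2 < z.1}.indicator
      (fun z => w z.1 * ψ z.2) z) (μ.prod volume) :=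
    (hw.mul_prod hψ).indicator (measurableSet_lt measurable_snd measurable_fst)
  have h1 := integral_integral_swap (f := fun s x => {z : ℝ × ℝ | z.2 < z.1}.indicator
      (fun z => w z.1 * ψ z.2) (s, x)) hi
  convert h1 using 1
  · congr 1; funext s
    rw [mul_comm, ← integral_const_mul, ← integral_indicator measurableSet_Iio]
    rfl
  · congr 1; funext x
    rw [← integral_const_mul, ← integral_indicator measurableSet_Ioi]
    congr 1; funext s
    simp only [indicator, mem_Ioi, mem_ofPred_eq, mul_comm]

theorem isLocallyFiniteMeasure_withDensity_of_le {f : ℝ → ℝ} {K : ℝ} (hf : ∀ x, f x ≤ K) :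
    IsLocallyFiniteMeasure (volume.withDensity fun x => ENNReal.ofReal (f x)) := by
  have h1 : (volume.withDensity fun x => ENNReal.ofReal (f x)) ≤
      (K.toNNReal : NNReal) • (volume : Measure ℝ) := by
    have := withDensity_mono (μ := (volume : Measure ℝ)) (f := fun x => ENNReal.ofReal (f x))
      (g := fun _ => ENNReal.ofReal K) (ae_of_all _ fun x => ENNReal.ofReal_le_ofReal (hf x))
    rwa [withDensity_const] at this
  exact Measure.isLocallyFiniteMeasure_of_le h1

theorem integral_withDensity_ofReal {f g : ℝ → ℝ} (hf : Measurable f) :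
    ∫ x, g x ∂(volume.withDensity fun x => ENNReal.ofReal (f x)) = ∫ x, g x * max (f x) 0 := by
  rw [integral_withDensity_eq_integral_toReal_smul hf.ennreal_ofReal (by simp)]
  refine integral_congr_ae (ae_of_all _ fun x => ?_)
  simp [ENNReal.toReal_ofReal', mul_comm]

/-- A finite measure that integrates test functions as a bounded function does against Lebesgue
measure has this function as its density. -/
theorem eq_withDensity_of_integral_eq {μ : Measure ℝ} [IsFiniteMeasure μ] {q : ℝ → ℝ} {K : ℝ}
    (hq : Measurable q) (hK : ∀ x, |q x| ≤ K)
    (h : ∀ ψ : C_c(ℝ, ℝ), ∫ x, ψ x ∂μ = ∫ x, ψ x * q x) :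
    (∀ᵐ x, 0 ≤ q x) ∧ μ = volume.withDensity fun x => ENNReal.ofReal (q x) := by
  have l1 := isLocallyFiniteMeasure_withDensity_of_le (f := q) fun x => (le_abs_self _).trans (hK x)
  have l2 := isLocallyFiniteMeasure_withDensity_of_le (f := fun x => - q x) fun x =>
    (neg_le_abs _).trans (hK x)
  have heq : μ + (volume.withDensity fun x => ENNReal.ofReal (- q x)) =
      volume.withDensity fun x => ENNReal.ofReal (q x) := by
    have l3 : IsFiniteMeasureOnCompacts
        (μ + (volume.withDensity fun x => ENNReal.ofReal (- q x))) :=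
      ⟨fun C hC => by
        rw [Measure.add_apply]
        exact ENNReal.add_lt_top.2 ⟨measure_lt_top _ _, hC.measure_lt_top⟩⟩
    have l4 : IsLocallyFiniteMeasure
        (μ + (volume.withDensity fun x => ENNReal.ofReal (- q x))) :=
      isLocallyFiniteMeasure_of_isFiniteMeasureOnCompacts
    refine Measure.ext_of_integral_eq_on_compactlySupported fun ψ => ?_
    have hψ : ∀ ν : Measure ℝ, IsLocallyFiniteMeasure ν → Integrable ψ ν := fun ν _ =>
      ψ.continuous.integrable_of_hasCompactSupport ψ.hasCompactSupport
    rw [integral_add_measure (hψ _ inferInstance) (hψ _ l2), h, integral_withDensity_ofReal hq,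
      integral_withDensity_ofReal (f := fun x => - q x) hq.neg, ← integral_add]
    · congr 1; funext x
      rcases le_total 0 (q x) with h0 | h0
      · rw [max_eq_left h0, max_eq_right (by linarith)]; ring
      · rw [max_eq_right h0, max_eq_left (by linarith)]; ring
    · exact (hψ _ inferInstance).mul_bdd hq.aestronglyMeasurable (ae_of_all _ hK)
    · refine (hψ _ inferInstance).mul_bdd (c := K) (hq.neg.max measurable_const).aestronglyMeasurable
        (ae_of_all _ fun x => ?_)
      rw [Real.norm_eq_abs, abs_of_nonneg (le_max_right _ _)]
      exact max_le ((neg_le_abs _).trans (hK x)) ((abs_nonneg _).trans (hK x))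
  have hN : MeasurableSet {x | q x < 0} := measurableSet_lt hq measurable_const
  have h0 : (volume.withDensity fun x => ENNReal.ofReal (q x)) {x | q x < 0} = 0 := by
    rw [withDensity_apply _ hN]
    refine setLIntegral_eq_zero hN fun x hx => ?_
    exact ENNReal.ofReal_of_nonpos (le_of_lt hx)
  rw [← heq, Measure.add_apply, add_eq_zero, withDensity_apply _ hN] at h0
  have h2 := (setLIntegral_eq_zero_iff hN hq.neg.ennreal_ofReal).1 h0.2
  have hnn : ∀ᵐ x, 0 ≤ q x := by
    filter_upwards [h2] with x hx
    by_contra hneg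
    push Not at hneg
    have := ENNReal.ofReal_eq_zero.1 (hx hneg)
    rw [Pi.neg_apply] at this
    linarith
  refine ⟨hnn, ?_⟩
  rw [← heq, withDensity_congr_ae (g := 0), withDensity_zero, add_zero]
  filter_upwards [hnn] with x hx
  exact ENNReal.ofReal_of_nonpos (by linarith)

theorem hasDerivAt_setIntegral_Iio {ψ : ℝ → ℝ} (hψ : Integrable ψ) (hc : Continuous ψ) (x : ℝ) :
    HasDerivAt (fun s => ∫ t in Iio s, ψ t) (ψ x) x := by
  have h1 : (fun s => ∫ t in Iio s, ψ t) =
      fun s => (∫ t in Iic (0 : ℝ), ψ t) + ∫ t in (0 : ℝ)..s, ψ t := by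
    funext s
    have := intervalIntegral.integral_Iic_sub_Iic (hψ.integrableOn (s := Iic 0))
      (hψ.integrableOn (s := Iic s))
    rw [← integral_Iic_eq_integral_Iio]
    linarith
  rw [h1]
  exact (intervalIntegral.integral_hasDerivAt_right hψ.intervalIntegrable
    hc.stronglyMeasurable.stronglyMeasurableAtFilter hc.continuousAt).const_add _

theorem hasACDensity_of_integral_eq {μ : Measure ℝ} [IsFiniteMeasure μ] {w : ℝ → ℝ}
    (hwm : Measurable w) (hw : Integrable w μ)
    (h : ∀ (φ φ' : ℝ → ℝ) (M : ℝ), (∀ x, HasDerivAt φ (φ' x) x) → Continuous φ' →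
      (∀ x, |φ x| ≤ M) → (∀ x, |φ' x| ≤ M) → ∫ x, φ' x ∂μ = ∫ x, φ x * w x ∂μ) :
    ∃ q : ℝ → ℝ, HasACDensity μ q (fun x => - (w x * q x)) := by
  set q : ℝ → ℝ := fun x => ∫ s in Ioi x, w s ∂μ with hq
  have hqm : Measurable q := measurable_setIntegral_Ioi hwm
  have hqK : ∀ x, |q x| ≤ ∫ s, |w s| ∂μ := fun x =>
    (abs_integral_le_integral_abs).trans
      (setIntegral_le_integral hw.abs (ae_of_all _ fun _ => abs_nonneg _))
  obtain ⟨hnn, hμ⟩ := eq_withDensity_of_integral_eq hqm hqK fun ψ => by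
    have hψ : Integrable ψ := ψ.continuous.integrable_of_hasCompactSupport ψ.hasCompactSupport
    rw [← integral_setIntegral_Iio_mul hw hψ]
    obtain ⟨B, hB⟩ := ψ.hasCompactSupport.exists_bound_of_continuous ψ.continuous
    refine h _ ψ (max B (∫ x, |ψ x|)) (hasDerivAt_setIntegral_Iio hψ ψ.continuous) ψ.continuous
      (fun x => le_max_of_le_right ?_) (fun x => le_max_of_le_left (hB x))
    exact (abs_integral_le_integral_abs).trans
      (setIntegral_le_integral hψ.abs (ae_of_all _ fun _ => abs_nonneg _))
  have hfin : ∀ᵐ x : ℝ, ENNReal.ofReal (q x) < ∞ := by simp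
  have htr : (fun x => (ENNReal.ofReal (q x)).toReal • w x) =ᵐ[volume] fun x => w x * q x := by
    filter_upwards [hnn] with x hx
    rw [ENNReal.toReal_ofReal hx, smul_eq_mul, mul_comm]
  have hwq : Integrable fun x => w x * q x := by
    have h1 := hw
    rw [hμ, integrable_withDensity_iff_integrable_smul' hqm.ennreal_ofReal hfin] at h1
    exact h1.congr htr
  have hqe : ∀ x, q x = ∫ s in Ioi x, w s * q s := fun x => by
    have h1 : q x = ∫ s in Ioi x, w s ∂(volume.withDensity fun x => ENNReal.ofReal (q x)) := by
      rw [← hμ]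
    rw [h1, restrict_withDensity measurableSet_Ioi,
      integral_withDensity_eq_integral_toReal_smul hqm.ennreal_ofReal
        (ae_restrict_of_ae hfin)]
    exact integral_congr_ae (ae_restrict_of_ae htr)
  have hsub : ∀ a b, ∫ x in a..b, - (w x * q x) = q b - q a := fun a b => by
    have := intervalIntegral.integral_Ioi_sub_Ioi' (μ := volume) (a := a) (b := b)
      (hwq.integrableOn (s := Ioi a)) (hwq.integrableOn (s := Ioi b))
    rw [intervalIntegral.integral_neg, ← this, ← hqe, ← hqe]
    ring
  have hqc : Continuous q := by
    have h1 : q = fun b => q 0 + ∫ x in (0 : ℝ)..b, - (w x * q x) := by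
      funext b; rw [hsub]; ring
    rw [h1]
    exact continuous_const.add (intervalIntegral.continuous_primitive
      (fun a b => hwq.neg.intervalIntegrable) 0)
  refine ⟨q, ?_, hμ, hwq.neg.locallyIntegrable, hsub⟩
  intro x
  by_contra hx
  have ho : IsOpen {x | q x < 0} := isOpen_lt hqc continuous_const
  have h0 : volume {x | q x < 0} = 0 := by
    rw [measure_eq_zero_iff_ae_notMem]
    filter_upwards [hnn] with y hy
    simpa using hy
  rw [ho.measure_eq_zero_iff volume] at h0
  exact (h0 ▸ (not_le.1 hx : x ∈ {x | q x < 0}) : x ∈ (∅ : Set ℝ))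

/-- If `W` satisfies the integration by parts formula `E[φ'(S)] = E[φ(S) W]`, then the score of
`S` is `-E[W | S]`, and hence `I(S‖Z) ≤ E[(W - S)²]`. -/
theorem fisherDistance_map_le {Ω : Type*} [mΩ : MeasurableSpace Ω] {P : Measure Ω}
    [IsProbabilityMeasure P] {S W : Ω → ℝ} (hS : Measurable S) (hSi : Integrable S P)
    (hW : Integrable W P)
    (h : ∀ (φ φ' : ℝ → ℝ) (M : ℝ), (∀ x, HasDerivAt φ (φ' x) x) → Continuous φ' →
      (∀ x, |φ x| ≤ M) → (∀ x, |φ' x| ≤ M) → ∫ ω, φ' (S ω) ∂P = ∫ ω, φ (S ω) * W ω ∂P) :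
    fisherDistance (P.map S) ≤ ∫⁻ ω, ENNReal.ofReal ((W ω - S ω) ^ 2) ∂P := by
  have hmle : MeasurableSpace.comap S inferInstance ≤ mΩ := hS.comap_le
  have hSm : Measurable[MeasurableSpace.comap S inferInstance] S := comap_measurable S
  obtain ⟨w, hwm, hw⟩ :=
    (stronglyMeasurable_condExp (f := W) (m := MeasurableSpace.comap S inferInstance) (μ := P)).measurable.exists_eq_measurable_comp
  have hwi : Integrable w (P.map S) := by
    rw [integrable_map_measure hwm.aestronglyMeasurable hS.aemeasurable, ← hw]
    exact integrable_condExp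
  have : IsProbabilityMeasure (P.map S) := Measure.isProbabilityMeasure_map hS.aemeasurable
  obtain ⟨q, hq⟩ := hasACDensity_of_integral_eq hwm hwi fun φ φ' M hφ hφ'c hφM hφ'M => by
    have hφc : Continuous φ := continuous_iff_continuousAt.2 fun x => (hφ x).continuousAt
    rw [integral_map hS.aemeasurable hφ'c.aestronglyMeasurable,
      integral_map hS.aemeasurable (f := fun x => φ x * w x)
        (hφc.measurable.mul hwm).aestronglyMeasurable,
      h φ φ' M hφ hφ'c hφM hφ'M]
    have hb : Integrable (fun ω => φ (S ω) * W ω) P :=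
      hW.bdd_mul (hφc.measurable.comp hS).aestronglyMeasurable (ae_of_all _ fun ω => hφM _)
    rw [← integral_condExp hmle]
    refine integral_congr_ae ?_
    have := condExp_mul_of_stronglyMeasurable_left (m := MeasurableSpace.comap S inferInstance) (μ := P) (f := fun ω => φ (S ω)) (g := W)
      (hφc.measurable.comp hSm).stronglyMeasurable hb hW
    refine this.trans (ae_of_all _ fun ω => ?_)
    simp [hw]
  rw [fisherDistance_eq hq]
  have e1 : ∫⁻ x, ENNReal.ofReal ((-(w x * q x) / q x + x) ^ 2) ∂(P.map S) =
      ∫⁻ x, ENNReal.ofReal ((w x - x) ^ 2) ∂(P.map S) := by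
    refine lintegral_congr_ae ?_
    have hne : ∀ᵐ x ∂(P.map S), q x ≠ 0 := by
      rw [hq.law_eq, ae_withDensity_iff hq.continuous.measurable.ennreal_ofReal]
      refine ae_of_all _ fun x hx h0 => hx ?_
      simp [h0]
    filter_upwards [hne] with x hx
    congr 1
    field_simp
    ring
  rw [e1, lintegral_map (by fun_prop) hS]
  have hce : P[fun ω => W ω - S ω | MeasurableSpace.comap S inferInstance] =ᵐ[P] fun ω => w (S ω) - S ω := by
    refine (condExp_sub hW hSi _).trans ?_
    rw [condExp_of_stronglyMeasurable hmle hSm.stronglyMeasurable hSi, hw]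
    rfl
  have hle := eLpNorm_condExp_le_eLpNorm (μ := P) (m := MeasurableSpace.comap S inferInstance) (fun ω => W ω - S ω) (p := 2) (by norm_num)
  rw [eLpNorm_congr_ae hce, eLpNorm_eq_lintegral_rpow_enorm_toReal (by norm_num) (by norm_num),
    eLpNorm_eq_lintegral_rpow_enorm_toReal (by norm_num) (by norm_num)] at hle
  rw [ENNReal.rpow_le_rpow_iff (by norm_num)] at hle
  have e2 : ∀ x : ℝ, ‖x‖ₑ ^ (2 : ℝ≥0∞).toReal = ENNReal.ofReal (x ^ 2) := fun x => by
    rw [ENNReal.toReal_ofNat, ENNReal.rpow_ofNat, Real.enorm_eq_ofReal_abs,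
      ← ENNReal.ofReal_pow (abs_nonneg _), sq_abs]
  simpa only [e2] using hle

theorem add_pow_eight_le (x y : ℝ) :
    (x + y) ^ 8 ≤ x ^ 8 + 8 * (x ^ 7 * y) + 247 * (x ^ 6 * y ^ 2 + y ^ 8) := by
  have key : ∀ i j : ℕ, i + j = 6 → x ^ i * y ^ (j + 2) ≤ x ^ 6 * y ^ 2 + y ^ 8 := by
    intro i j hij
    have h1 : x ^ i * y ^ (j + 2) ≤ |x| ^ i * |y| ^ (j + 2) := by
      rw [← abs_pow, ← abs_pow, ← abs_mul]; exact le_abs_self _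
    have h6 : x ^ 6 * y ^ 2 = |x| ^ 6 * |y| ^ 2 := by
      rw [← abs_pow, ← abs_pow, ← abs_mul, abs_of_nonneg (by positivity)]
    have h8 : y ^ 8 = |y| ^ 8 := by rw [← abs_pow, abs_of_nonneg (by positivity)]
    rw [h6, h8]
    refine h1.trans ?_
    have ha := abs_nonneg x
    have hb := abs_nonneg y
    rcases le_total |x| |y| with h | h
    · calc |x| ^ i * |y| ^ (j + 2) ≤ |y| ^ i * |y| ^ (j + 2) := by gcongr
        _ = |y| ^ 8 := by rw [← pow_add]; congr 1; omega
        _ ≤ _ := le_add_of_nonneg_left (by positivity)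
    · calc |x| ^ i * |y| ^ (j + 2) = |x| ^ i * |y| ^ j * |y| ^ 2 := by ring
        _ ≤ |x| ^ i * |x| ^ j * |y| ^ 2 := by gcongr
        _ = |x| ^ 6 * |y| ^ 2 := by rw [← pow_add, hij]
        _ ≤ _ := le_add_of_nonneg_right (by positivity)
  have k0 := key 6 0 rfl
  have k1 := key 5 1 rfl
  have k2 := key 4 2 rfl
  have k3 := key 3 3 rfl
  have k4 := key 2 4 rfl
  have k5 := key 1 5 rfl
  have k6 := key 0 6 rfl
  norm_num at k0 k1 k2 k3 k4 k5 k6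
  have e : (x + y) ^ 8 = x ^ 8 + 8 * (x ^ 7 * y) + 28 * (x ^ 6 * y ^ 2) + 56 * (x ^ 5 * y ^ 3) +
    70 * (x ^ 4 * y ^ 4) + 56 * (x ^ 3 * y ^ 5) + 28 * (x ^ 2 * y ^ 6) + 8 * (x * y ^ 7) + y ^ 8 := by
    ring
  rw [e]
  have : 0 ≤ x ^ 6 * y ^ 2 := by positivity
  linarith

theorem abs_pow_le_one_add_pow_eight (x : ℝ) {j : ℕ} (hj : j ≤ 8) : |x| ^ j ≤ 1 + x ^ 8 := by
  have h8 : x ^ 8 = |x| ^ 8 := by rw [← abs_pow, abs_of_nonneg (by positivity)]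
  rw [h8]
  rcases le_total |x| 1 with h | h
  · exact (pow_le_one₀ (abs_nonneg x) h).trans (le_add_of_nonneg_right (by positivity))
  · exact (pow_le_pow_right₀ h hj).trans (by linarith)

theorem mul_pow_six_le {D m : ℝ} (hD : 0 ≤ D) (hm : 0 < m) (x : ℝ) :
    D * x ^ 6 ≤ x ^ 8 / m + D ^ 4 * m ^ 3 := by
  have hx : 0 ≤ x ^ 2 := sq_nonneg x
  rcases le_total (D * m) (x ^ 2) with h | h
  · have : D * x ^ 6 ≤ x ^ 8 / m := by
      rw [le_div_iff₀ hm]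
      calc D * x ^ 6 * m = (D * m) * (x ^ 2) ^ 3 := by ring
        _ ≤ x ^ 2 * (x ^ 2) ^ 3 := by gcongr
        _ = x ^ 8 := by ring
    have : 0 ≤ D ^ 4 * m ^ 3 := by positivity
    linarith
  · have : D * x ^ 6 ≤ D ^ 4 * m ^ 3 := by
      calc D * x ^ 6 = D * (x ^ 2) ^ 3 := by ring
        _ ≤ D * (D * m) ^ 3 := by gcongr
        _ = D ^ 4 * m ^ 3 := by ring
    have : 0 ≤ x ^ 8 / m := by positivity
    linarith

section

variable {Ω : Type*} [MeasurableSpace Ω] {P : Measure Ω} [IsProbabilityMeasure P]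

theorem integrable_pow_of_pow_eight {Y : Ω → ℝ} (hm : Measurable Y)
    (h : Integrable (fun ω => Y ω ^ 8) P) {j : ℕ} (hj : j ≤ 8) :
    Integrable (fun ω => Y ω ^ j) P := by
  refine ((integrable_const (1 : ℝ)).add h).mono' (hm.pow_const j).aestronglyMeasurable
    (ae_of_all _ fun ω => ?_)
  rw [Real.norm_eq_abs, abs_pow]
  exact abs_pow_le_one_add_pow_eight _ hj

theorem integral_sq_le_one_add {Y : Ω → ℝ} (hm : Measurable Y)
    (h : Integrable (fun ω => Y ω ^ 8) P) : ∫ ω, Y ω ^ 2 ∂P ≤ 1 + ∫ ω, Y ω ^ 8 ∂P := by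
  have h1 : ∫ ω, (1 + Y ω ^ 8) ∂P = 1 + ∫ ω, Y ω ^ 8 ∂P := by
    rw [integral_add (integrable_const _) h]; simp
  rw [← h1]
  refine integral_mono (integrable_pow_of_pow_eight hm h (by norm_num))
    ((integrable_const _).add h) fun ω => ?_
  rw [← sq_abs]
  exact abs_pow_le_one_add_pow_eight _ (by norm_num)

theorem integral_add_pow_eight_le {U Y : Ω → ℝ} {B m : ℝ} (hU : Measurable U) (hY : Measurable Y)
    (hi : IndepFun U Y P) (hU8 : Integrable (fun ω => U ω ^ 8) P)
    (hY8 : Integrable (fun ω => Y ω ^ 8) P) (hY0 : ∫ ω, Y ω ∂P = 0)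
    (hB : ∫ ω, Y ω ^ 8 ∂P ≤ B) (hm : 0 < m) :
    Integrable (fun ω => (U ω + Y ω) ^ 8) P ∧
    ∫ ω, (U ω + Y ω) ^ 8 ∂P ≤
      (1 + 1 / m) * ∫ ω, U ω ^ 8 ∂P + ((247 * (1 + B)) ^ 4 * m ^ 3 + 247 * B) := by
  have hB0 : 0 ≤ B := (integral_nonneg fun ω => by positivity).trans hB
  have i7 := integrable_pow_of_pow_eight hU hU8 (j := 7) (by norm_num)
  have i6 := integrable_pow_of_pow_eight hU hU8 (j := 6) (by norm_num)
  have j1 : Integrable Y P := by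
    simpa using integrable_pow_of_pow_eight hY hY8 (j := 1) (by norm_num)
  have j2 := integrable_pow_of_pow_eight hY hY8 (j := 2) (by norm_num)
  have ind7 : IndepFun (fun ω => U ω ^ 7) Y P :=
    hi.comp (φ := fun x : ℝ => x ^ 7) (ψ := id) (by fun_prop) measurable_id
  have ind6 : IndepFun (fun ω => U ω ^ 6) (fun ω => Y ω ^ 2) P :=
    hi.comp (φ := fun x : ℝ => x ^ 6) (ψ := fun x : ℝ => x ^ 2) (by fun_prop) (by fun_prop)
  have k7 : Integrable (fun ω => U ω ^ 7 * Y ω) P := ind7.integrable_mul i7 j1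
  have k6 : Integrable (fun ω => U ω ^ 6 * Y ω ^ 2) P := ind6.integrable_mul i6 j2
  have e7 : ∫ ω, U ω ^ 7 * Y ω ∂P = 0 := by
    rw [ind7.integral_fun_mul_eq_mul_integral i7.1 j1.1, hY0, mul_zero]
  have e6 := ind6.integral_fun_mul_eq_mul_integral i6.1 j2.1
  have hdom := (hU8.add (k7.const_mul 8)).add ((k6.add hY8).const_mul 247)
  have hint : Integrable (fun ω => (U ω + Y ω) ^ 8) P := by
    refine hdom.mono' ((hU.add hY).pow_const 8).aestronglyMeasurable (ae_of_all _ fun ω => ?_)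
    rw [Real.norm_eq_abs, abs_of_nonneg (by positivity)]
    exact add_pow_eight_le _ _
  refine ⟨hint, ?_⟩
  have h1 : ∫ ω, (U ω + Y ω) ^ 8 ∂P ≤ ∫ ω, U ω ^ 8 ∂P +
      247 * ((∫ ω, U ω ^ 6 ∂P) * (∫ ω, Y ω ^ 2 ∂P) + ∫ ω, Y ω ^ 8 ∂P) := by
    calc _ ≤ ∫ ω, (U ω ^ 8 + 8 * (U ω ^ 7 * Y ω) + 247 * (U ω ^ 6 * Y ω ^ 2 + Y ω ^ 8)) ∂P :=
          integral_mono hint hdom fun ω => add_pow_eight_le _ _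
      _ = _ := by
          rw [integral_add (f := fun ω => U ω ^ 8 + 8 * (U ω ^ 7 * Y ω))
              (g := fun ω => 247 * (U ω ^ 6 * Y ω ^ 2 + Y ω ^ 8))
              (hU8.add (k7.const_mul 8)) ((k6.add hY8).const_mul 247),
            integral_add hU8 (k7.const_mul 8), integral_const_mul, integral_const_mul,
            integral_add k6 hY8, e7, e6]
          ring
  have h2 : (∫ ω, U ω ^ 6 ∂P) * (∫ ω, Y ω ^ 2 ∂P) ≤ (∫ ω, U ω ^ 6 ∂P) * (1 + B) := by
    refine mul_le_mul_of_nonneg_left ?_ (integral_nonneg fun ω => by positivity)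
    exact (integral_sq_le_one_add hY hY8).trans (by linarith)
  have h3 : 247 * (1 + B) * ∫ ω, U ω ^ 6 ∂P ≤
      (∫ ω, U ω ^ 8 ∂P) / m + (247 * (1 + B)) ^ 4 * m ^ 3 := by
    rw [← integral_const_mul]
    have : ∫ ω, (U ω ^ 8 / m + (247 * (1 + B)) ^ 4 * m ^ 3) ∂P =
        (∫ ω, U ω ^ 8 ∂P) / m + (247 * (1 + B)) ^ 4 * m ^ 3 := by
      rw [integral_add (hU8.div_const m) (integrable_const _), integral_div]; simp
    rw [← this]
    exact integral_mono (i6.const_mul _) ((hU8.div_const m).add (integrable_const _)) fun ω =>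
      mul_pow_six_le (by positivity) hm _
  have h4 : (1 + 1 / m) * ∫ ω, U ω ^ 8 ∂P = ∫ ω, U ω ^ 8 ∂P + (∫ ω, U ω ^ 8 ∂P) / m := by ring
  rw [h4]
  linarith

/-- The eighth moment of a sum of `n` independent centred random variables is `O(n⁴)`. -/
theorem integral_sum_pow_eight_le {Y : ℕ → Ω → ℝ} {B : ℝ} (hY : ∀ k, Measurable (Y k))
    (hi : iIndepFun Y P) (hY8 : ∀ k, Integrable (fun ω => Y k ω ^ 8) P)
    (hY0 : ∀ k, ∫ ω, Y k ω ∂P = 0) (hB : ∀ k, ∫ ω, Y k ω ^ 8 ∂P ≤ B) (n : ℕ) :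
    Integrable (fun ω => (∑ k ∈ Finset.range n, Y k ω) ^ 8) P ∧
    ∫ ω, (∑ k ∈ Finset.range n, Y k ω) ^ 8 ∂P ≤
      ((247 * (1 + B)) ^ 4 + 247 * B) * (n : ℝ) ^ 4 := by
  have hB0 : 0 ≤ B := (integral_nonneg fun ω => by positivity).trans (hB 0)
  induction n with
  | zero => simp
  | succ n ih =>
    rcases Nat.eq_zero_or_pos n with rfl | hn
    · refine ⟨by simpa using hY8 0, ?_⟩
      have : 0 ≤ (247 * (1 + B)) ^ 4 := by positivity
      simpa using (hB 0).trans (by linarith)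
    · have hind : IndepFun (fun ω => ∑ k ∈ Finset.range n, Y k ω) (Y n) P := by
        have := hi.indepFun_sum_range_succ hY n
        convert this using 1
        funext ω; simp
      have hn0 : (0 : ℝ) < n := by exact_mod_cast hn
      have hn1 : (1 : ℝ) ≤ n := by exact_mod_cast hn
      simp only [Finset.sum_range_succ]
      obtain ⟨h1, h2⟩ := integral_add_pow_eight_le (m := n)
        (Finset.measurable_fun_sum _ fun k _ => hY k) (hY n) hind ih.1 (hY8 n) (hY0 n) (hB n) hn0
      refine ⟨h1, h2.trans ?_⟩
      set A := (247 * (1 + B)) ^ 4 + 247 * B with hA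
      have hD : 0 ≤ (247 * (1 + B)) ^ 4 := by positivity
      have hA0 : 0 ≤ A := by positivity
      have h3 : (1 + 1 / (n : ℝ)) * ∫ ω, (∑ k ∈ Finset.range n, Y k ω) ^ 8 ∂P ≤
          (1 + 1 / (n : ℝ)) * (A * (n : ℝ) ^ 4) :=
        mul_le_mul_of_nonneg_left ih.2 (by positivity)
      have h4 : (1 + 1 / (n : ℝ)) * (A * (n : ℝ) ^ 4) = A * (n : ℝ) ^ 4 + A * (n : ℝ) ^ 3 := by
        field_simp
      have h5 : 247 * B ≤ 247 * B * (n : ℝ) ^ 3 :=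
        le_mul_of_one_le_right (by positivity) (one_le_pow₀ hn1)
      have h6 : (247 * (1 + B)) ^ 4 * (n : ℝ) ^ 3 + 247 * B * (n : ℝ) ^ 3 = A * (n : ℝ) ^ 3 := by
        rw [hA]; ring
      have h7 : A * ((n : ℝ) + 1) ^ 4 = A * (n : ℝ) ^ 4 + 4 * (A * (n : ℝ) ^ 3) +
          A * (6 * (n : ℝ) ^ 2 + 4 * n + 1) := by ring
      have h8 : 0 ≤ A * (n : ℝ) ^ 3 := by positivity
      have h9 : 0 ≤ A * (6 * (n : ℝ) ^ 2 + 4 * n + 1) := by positivity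
      push_cast
      rw [h7]
      linarith

end

theorem exp_neg_le_one_sub_add_sq {x : ℝ} (hx : 0 ≤ x) : Real.exp (-x) ≤ 1 - x + x ^ 2 := by
  rcases le_total x 1 with h | h
  · have h1 := Real.abs_exp_sub_one_sub_id_le (x := -x) (by rw [abs_neg, abs_of_nonneg hx]; exact h)
    have h2 := (abs_le.1 h1).2
    nlinarith
  · have : Real.exp (-x) ≤ 1 := Real.exp_le_one_iff.2 (by linarith)
    nlinarith

theorem iIndepFun.indepFun_sum_sum {Ω : Type*} [MeasurableSpace Ω]
    {P : Measure Ω} {V : ℕ → Ω → ℝ} (hi : iIndepFun V P)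
    (hV : ∀ k, Measurable (V k)) {s t : Finset ℕ} (hst : Disjoint s t) :
    IndepFun (fun ω => ∑ k ∈ s, V k ω) (fun ω => ∑ k ∈ t, V k ω) P := by
  have h0 := hi.indepFun_finset s t hst hV
  have m : ∀ u : Finset ℕ, Measurable fun x : u → ℝ => ∑ j, x j := fun u =>
    Finset.measurable_fun_sum _ fun j _ => measurable_pi_apply j
  refine (h0.comp (m s) (m t)).congr (ae_of_all _ fun ω => ?_) (ae_of_all _ fun ω => ?_)
  · exact Finset.sum_coe_sort s (fun j => V j ω)
  · exact Finset.sum_coe_sort t (fun j => V j ω)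

section

variable {Ω : Type*} [MeasurableSpace Ω] {P : Measure Ω} [IsProbabilityMeasure P]

theorem lintegral_exp_half_sub_le {V : Ω → ℝ} {b : ℝ} (hb : 0 < b) (hV0 : ∀ ω, 0 ≤ V ω)
    (hVi : Integrable V P) (hV2 : Integrable (fun ω => V ω ^ 2) P) (h1 : ∫ ω, V ω ∂P = 1)
    (h2 : ∫ ω, V ω ^ 2 ∂P ≤ b) :
    ∫⁻ ω, ENNReal.ofReal (Real.exp (1 / (4 * b) * (1 / 2 - V ω))) ∂P ≤
      ENNReal.ofReal (Real.exp (-(1 / (16 * b)))) := by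
  set l : ℝ := 1 / (4 * b) with hl
  have hl0 : 0 < l := by positivity
  have hint : Integrable (fun ω => Real.exp (l / 2) * (1 - l * V ω + l ^ 2 * V ω ^ 2)) P :=
    (((integrable_const 1).sub (hVi.const_mul l)).add (hV2.const_mul (l ^ 2))).const_mul _
  have hle : ∀ ω, Real.exp (l * (1 / 2 - V ω)) ≤
      Real.exp (l / 2) * (1 - l * V ω + l ^ 2 * V ω ^ 2) := fun ω => by
    have e : l * (1 / 2 - V ω) = l / 2 + -(l * V ω) := by ring
    rw [e, Real.exp_add]
    have := exp_neg_le_one_sub_add_sq (mul_nonneg hl0.le (hV0 ω))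
    rw [mul_pow] at this
    gcongr
  calc _ ≤ ∫⁻ ω, ENNReal.ofReal (Real.exp (l / 2) * (1 - l * V ω + l ^ 2 * V ω ^ 2)) ∂P :=
        lintegral_mono fun ω => ENNReal.ofReal_le_ofReal (hle ω)
    _ = ENNReal.ofReal (∫ ω, Real.exp (l / 2) * (1 - l * V ω + l ^ 2 * V ω ^ 2) ∂P) :=
        (ofReal_integral_eq_lintegral_ofReal hint
          (ae_of_all _ fun ω => (Real.exp_pos _).le.trans (hle ω))).symm
    _ ≤ _ := by
        refine ENNReal.ofReal_le_ofReal ?_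
        rw [integral_const_mul, integral_add (f := fun ω => 1 - l * V ω)
            ((integrable_const 1).sub (hVi.const_mul l)) (hV2.const_mul (l ^ 2)),
          integral_sub (integrable_const 1) (hVi.const_mul l), integral_const_mul,
          integral_const_mul, h1]
        simp only [integral_const, probReal_univ, smul_eq_mul, mul_one]
        have h3 : 1 - l + l ^ 2 * ∫ ω, V ω ^ 2 ∂P ≤ Real.exp (-l + l ^ 2 * b) := by
          have := Real.add_one_le_exp (-l + l ^ 2 * b)
          have := mul_le_mul_of_nonneg_left h2 (sq_nonneg l)
          linarith
        calc _ ≤ Real.exp (l / 2) * Real.exp (-l + l ^ 2 * b) := by gcongr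
          _ = Real.exp (-(1 / (16 * b))) := by
            rw [← Real.exp_add]
            congr 1
            rw [hl]; field_simp; ring

theorem lintegral_exp_sum_le {V : ℕ → Ω → ℝ} {b : ℝ} (hb : 0 < b) (hi : iIndepFun V P)
    (hV : ∀ k, Measurable (V k)) (hV0 : ∀ k ω, 0 ≤ V k ω)
    (hVi : ∀ k, Integrable (V k) P) (hV2 : ∀ k, Integrable (fun ω => V k ω ^ 2) P)
    (h1 : ∀ k, ∫ ω, V k ω ∂P = 1) (h2 : ∀ k, ∫ ω, V k ω ^ 2 ∂P ≤ b) (s : Finset ℕ) :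
    ∫⁻ ω, ENNReal.ofReal (Real.exp (1 / (4 * b) * ((s.card : ℝ) / 2 - ∑ k ∈ s, V k ω))) ∂P ≤
      ENNReal.ofReal (Real.exp (-(1 / (16 * b)) * s.card)) := by
  have hm : Measurable fun x : ℝ => ENNReal.ofReal (Real.exp (1 / (4 * b) * (1 / 2 - x))) := by
    fun_prop
  have hp := lintegral_prod_eq_prod_lintegral_of_indepFun s
    (fun k ω => ENNReal.ofReal (Real.exp (1 / (4 * b) * (1 / 2 - V k ω))))
    (hi.comp (fun _ x => ENNReal.ofReal (Real.exp (1 / (4 * b) * (1 / 2 - x)))) fun _ => hm)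
    (fun k => hm.comp (hV k))
  have e : ∀ ω, ENNReal.ofReal (Real.exp (1 / (4 * b) * ((s.card : ℝ) / 2 - ∑ k ∈ s, V k ω))) =
      ∏ k ∈ s, ENNReal.ofReal (Real.exp (1 / (4 * b) * (1 / 2 - V k ω))) := fun ω => by
    rw [← ENNReal.ofReal_prod_of_nonneg fun k _ => (Real.exp_pos _).le, ← Real.exp_sum]
    congr 2
    rw [← Finset.mul_sum, Finset.sum_sub_distrib]
    simp [div_eq_mul_inv]
  simp only [e]
  rw [hp]
  refine (Finset.prod_le_prod' fun k _ =>
    lintegral_exp_half_sub_le hb (hV0 k) (hVi k) (hV2 k) (h1 k) (h2 k)).trans (le_of_eq ?_)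
  rw [Finset.prod_const, ← ENNReal.ofReal_pow (Real.exp_pos _).le, ← Real.exp_nat_mul, mul_comm]

theorem pow_mul_inv_enorm_le {n₀ r : ℕ} (hr : 1 ≤ r) {l T R : ℝ} (hl : 0 ≤ l) (hT : 0 ≤ T)
    (hR : 0 ≤ R) :
    ((n₀ + r : ℕ) : ℝ≥0∞) ^ 8 * (‖T + R‖ₑ ^ 8)⁻¹ ≤ ENNReal.ofReal ((2 * (n₀ + 1)) ^ 8) +
      ((n₀ + r : ℕ) : ℝ≥0∞) ^ 8 *
        ((‖T‖ₑ ^ 8)⁻¹ * ENNReal.ofReal (Real.exp (l * ((r : ℝ) / 2 - R)))) := by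
  have hr1 : (1 : ℝ) ≤ r := by exact_mod_cast hr
  rcases le_or_gt ((r : ℝ) / 2) R with h | h
  · refine le_add_right ?_
    have hpos : 0 < T + R := by linarith
    have e : ((n₀ + r : ℕ) : ℝ≥0∞) = ENNReal.ofReal ((n₀ : ℝ) + r) := by
      rw [← Nat.cast_add, ENNReal.ofReal_natCast]
    rw [e, Real.enorm_of_nonneg hpos.le, ← ENNReal.ofReal_pow (by positivity),
      ← ENNReal.ofReal_pow (by positivity), ← ENNReal.ofReal_inv_of_pos (by positivity),
      ← ENNReal.ofReal_mul (by positivity)]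
    refine ENNReal.ofReal_le_ofReal ?_
    rw [← inv_pow, ← mul_pow]
    refine pow_le_pow_left₀ (by positivity) ?_ 8
    rw [← div_eq_mul_inv, div_le_iff₀ hpos]
    have h0 : (0 : ℝ) ≤ n₀ := n₀.cast_nonneg
    have h1 : (n₀ : ℝ) + r ≤ (n₀ + 1) * r := by nlinarith
    have h2 : (2 * ((n₀ : ℝ) + 1)) * (r / 2) ≤ 2 * ((n₀ : ℝ) + 1) * (T + R) := by
      gcongr; linarith
    linarith
  · refine le_add_left ?_
    gcongr
    calc (‖T + R‖ₑ ^ 8)⁻¹ ≤ (‖T‖ₑ ^ 8)⁻¹ * 1 := by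
          rw [mul_one]
          gcongr ?_⁻¹
          gcongr ?_ ^ 8
          rw [Real.enorm_of_nonneg hT, Real.enorm_of_nonneg (by positivity)]
          exact ENNReal.ofReal_le_ofReal (by linarith)
      _ ≤ _ := by
          gcongr
          rw [ENNReal.one_le_ofReal]
          exact Real.one_le_exp (mul_nonneg hl (by linarith))

/-- The normalised negative eighth moments of the sums of independent nonnegative random variables
with mean one and bounded second moments are bounded once one of them is finite. -/
theorem iSup_negative_moment_lt_top {V : ℕ → Ω → ℝ} {b : ℝ} (hb : 0 < b) (hi : iIndepFun V P)
    (hV : ∀ k, Measurable (V k)) (hV0 : ∀ k ω, 0 ≤ V k ω)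
    (hVi : ∀ k, Integrable (V k) P) (hV2 : ∀ k, Integrable (fun ω => V k ω ^ 2) P)
    (h1 : ∀ k, ∫ ω, V k ω ∂P = 1) (h2 : ∀ k, ∫ ω, V k ω ^ 2 ∂P ≤ b) {n₀ : ℕ}
    (h0 : ∫⁻ ω, (‖∑ k ∈ Finset.range n₀, V k ω‖ₑ ^ 8)⁻¹ ∂P < ∞) :
    ⨆ n ≥ n₀, (n : ℝ≥0∞) ^ 8 * ∫⁻ ω, (‖∑ k ∈ Finset.range n, V k ω‖ₑ ^ 8)⁻¹ ∂P < ∞ := by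
  set N := ∫⁻ ω, (‖∑ k ∈ Finset.range n₀, V k ω‖ₑ ^ 8)⁻¹ ∂P with hN
  set δ : ℝ := 1 / (16 * b) with hδ
  have hδ0 : 0 < δ := by positivity
  have hsum : ∀ s : Finset ℕ, Measurable fun ω => ∑ k ∈ s, V k ω := fun s =>
    Finset.measurable_fun_sum _ fun k _ => hV k
  have hsum0 : ∀ (s : Finset ℕ) ω, 0 ≤ ∑ k ∈ s, V k ω := fun s ω =>
    Finset.sum_nonneg fun k _ => hV0 k ω
  set Q : ℝ≥0∞ := ENNReal.ofReal (((n₀ : ℝ) + 1) ^ 8 * ((Nat.factorial 8 : ℝ) / δ ^ 8)) with hQ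
  have hbound : ∀ n ≥ n₀, (n : ℝ≥0∞) ^ 8 * ∫⁻ ω, (‖∑ k ∈ Finset.range n, V k ω‖ₑ ^ 8)⁻¹ ∂P ≤
      (n₀ : ℝ≥0∞) ^ 8 * N + (ENNReal.ofReal ((2 * (n₀ + 1)) ^ 8) + Q * N) := by
    intro n hn
    obtain ⟨r, rfl⟩ := Nat.exists_eq_add_of_le hn
    rcases Nat.eq_zero_or_pos r with rfl | hr
    · exact le_add_right le_rfl
    refine le_add_left ?_
    set s : Finset ℕ := Finset.Ico n₀ (n₀ + r) with hs
    have hcard : s.card = r := by simp [hs]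
    have hdisj : Disjoint (Finset.range n₀) s := by
      rw [Finset.disjoint_left]
      intro a ha hb
      simp [hs] at ha hb
      omega
    have hexp := lintegral_exp_sum_le hb hi hV hV0 hVi hV2 h1 h2 s
    rw [hcard] at hexp
    set l : ℝ := 1 / (4 * b) with hl
    have mE : Measurable fun x : ℝ => ENNReal.ofReal (Real.exp (l * ((r : ℝ) / 2 - x))) := by
      fun_prop
    have mI : Measurable fun x : ℝ => (‖x‖ₑ ^ 8)⁻¹ := by fun_prop
    have hprod := lintegral_mul_eq_lintegral_mul_lintegral_of_indepFun''
      (mI.comp (hsum (Finset.range n₀))).aemeasurable (mE.comp (hsum s)).aemeasurable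
      ((iIndepFun.indepFun_sum_sum hi hV hdisj).comp mI mE)
    simp only [Function.comp] at hprod
    have mIs : Measurable fun ω => (‖∑ k ∈ Finset.range n₀, V k ω‖ₑ ^ 8)⁻¹ := mI.comp (hsum _)
    have mIn : Measurable fun ω => (‖∑ k ∈ Finset.range (n₀ + r), V k ω‖ₑ ^ 8)⁻¹ :=
      mI.comp (hsum _)
    have mEs : Measurable fun ω =>
      ENNReal.ofReal (Real.exp (l * ((r : ℝ) / 2 - ∑ k ∈ s, V k ω))) := mE.comp (hsum s)
    have mIE : Measurable fun ω => (‖∑ k ∈ Finset.range n₀, V k ω‖ₑ ^ 8)⁻¹ *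
        ENNReal.ofReal (Real.exp (l * ((r : ℝ) / 2 - ∑ k ∈ s, V k ω))) := mIs.mul mEs
    rw [← lintegral_const_mul _ mIn]
    calc _ ≤ ∫⁻ ω, (ENNReal.ofReal ((2 * (n₀ + 1)) ^ 8) + ((n₀ + r : ℕ) : ℝ≥0∞) ^ 8 *
          ((‖∑ k ∈ Finset.range n₀, V k ω‖ₑ ^ 8)⁻¹ *
            ENNReal.ofReal (Real.exp (l * ((r : ℝ) / 2 - ∑ k ∈ s, V k ω))))) ∂P := by
          refine lintegral_mono fun ω => ?_
          rw [← Finset.sum_range_add_sum_Ico (fun k => V k ω) hn]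
          exact pow_mul_inv_enorm_le hr (by positivity) (hsum0 _ ω) (hsum0 _ ω)
      _ = ENNReal.ofReal ((2 * (n₀ + 1)) ^ 8) + ((n₀ + r : ℕ) : ℝ≥0∞) ^ 8 * (N *
          ∫⁻ ω, ENNReal.ofReal (Real.exp (l * ((r : ℝ) / 2 - ∑ k ∈ s, V k ω))) ∂P) := by
          rw [lintegral_add_left measurable_const, lintegral_const, measure_univ, mul_one,
            lintegral_const_mul _ mIE, hprod]
      _ ≤ ENNReal.ofReal ((2 * (n₀ + 1)) ^ 8) + ((n₀ + r : ℕ) : ℝ≥0∞) ^ 8 * (N *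
          ENNReal.ofReal (Real.exp (-δ * r))) := by gcongr
      _ ≤ _ := by
          refine add_le_add le_rfl ?_
          rw [mul_comm N, ← mul_assoc]
          gcongr
          have e : ((n₀ + r : ℕ) : ℝ≥0∞) = ENNReal.ofReal ((n₀ : ℝ) + r) := by
            rw [← Nat.cast_add, ENNReal.ofReal_natCast]
          rw [e, ← ENNReal.ofReal_pow (by positivity), ← ENNReal.ofReal_mul (by positivity)]
          refine ENNReal.ofReal_le_ofReal ?_
          have hr1 : (1 : ℝ) ≤ r := by exact_mod_cast hr
          have h0 : (0 : ℝ) ≤ n₀ := n₀.cast_nonneg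
          have h3 : (n₀ : ℝ) + r ≤ (n₀ + 1) * r := by nlinarith
          have h4 := Real.pow_div_factorial_le_exp (δ * r) (by positivity) 8
          have h5 : (r : ℝ) ^ 8 * Real.exp (-δ * r) ≤ (Nat.factorial 8 : ℝ) / δ ^ 8 := by
            rw [neg_mul, Real.exp_neg, ← div_eq_mul_inv, div_le_div_iff₀ (Real.exp_pos _)
              (by positivity)]
            rw [div_le_iff₀ (by positivity), mul_pow] at h4
            linarith
          calc ((n₀ : ℝ) + r) ^ 8 * Real.exp (-δ * r)
              ≤ ((n₀ + 1) * r) ^ 8 * Real.exp (-δ * r) := by gcongr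
            _ = ((n₀ : ℝ) + 1) ^ 8 * ((r : ℝ) ^ 8 * Real.exp (-δ * r)) := by ring
            _ ≤ _ := by gcongr
  refine lt_of_le_of_lt (iSup₂_le hbound) ?_
  refine ENNReal.add_lt_top.2 ⟨ENNReal.mul_lt_top (by finiteness) h0,
    ENNReal.add_lt_top.2 ⟨ENNReal.ofReal_lt_top, ENNReal.mul_lt_top ENNReal.ofReal_lt_top h0⟩⟩

end

theorem sq_sub_le_of_pow_eight (a b c d : ℝ) :
    (-(a * b * c) + d * c ^ 2) ^ 2 ≤ 2 * (3 + a ^ 8 + b ^ 8 + 2 * c ^ 8 + d ^ 4) := by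
  have h1 : (-(a * b * c) + d * c ^ 2) ^ 2 ≤ 2 * ((a * b * c) ^ 2 + (d * c ^ 2) ^ 2) := by
    nlinarith [sq_nonneg (a * b * c + d * c ^ 2)]
  have h2 : (d * c ^ 2) ^ 2 ≤ d ^ 4 + c ^ 8 := by
    nlinarith [sq_nonneg (d ^ 2 - c ^ 4), sq_nonneg (d ^ 2), sq_nonneg (c ^ 4)]
  have h3 : (a * b * c) ^ 2 ≤ a ^ 6 + b ^ 6 + c ^ 6 := by
    have key : ∀ x y z : ℝ, 0 ≤ x → 0 ≤ y → 0 ≤ z → x * y * z ≤ x ^ 3 + y ^ 3 + z ^ 3 := by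
      intro x y z hx hy hz
      nlinarith [mul_nonneg (add_nonneg (add_nonneg hx hy) hz) (sq_nonneg (x - y)),
        mul_nonneg (add_nonneg (add_nonneg hx hy) hz) (sq_nonneg (y - z)),
        mul_nonneg (add_nonneg (add_nonneg hx hy) hz) (sq_nonneg (x - z)),
        mul_nonneg (mul_nonneg hx hy) hz]
    have := key (a ^ 2) (b ^ 2) (c ^ 2) (sq_nonneg _) (sq_nonneg _) (sq_nonneg _)
    calc (a * b * c) ^ 2 = a ^ 2 * b ^ 2 * c ^ 2 := by ring
      _ ≤ _ := this
      _ = _ := by ring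
  have h6 : ∀ x : ℝ, x ^ 6 ≤ 1 + x ^ 8 := fun x => by
    have := abs_pow_le_one_add_pow_eight x (j := 6) (by norm_num)
    rwa [← abs_pow, abs_of_nonneg (by positivity)] at this
  have := h6 a
  have := h6 b
  have := h6 c
  linarith

theorem sub_one_pow_eight_le (x : ℝ) : (x - 1) ^ 8 ≤ 128 * (x ^ 8 + 1) := by
  have h1 : |x - 1| ≤ |x| + 1 := by simpa using abs_sub x 1
  have h2 := add_pow_le (abs_nonneg x) zero_le_one 8
  have e : ∀ y : ℝ, y ^ 8 = |y| ^ 8 := fun y => by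
    rw [← abs_pow, abs_of_nonneg (by positivity)]
  rw [e (x - 1), e x]
  calc |x - 1| ^ 8 ≤ (|x| + 1) ^ 8 := by gcongr
    _ ≤ _ := by norm_num at h2; exact h2

theorem mean_mul_pow_four_le {n : ℕ} (hn : 0 < n) (u v : ℕ → ℝ) :
    ((∑ k ∈ Finset.range n, u k * v k) / n) ^ 4 ≤
      (∑ k ∈ Finset.range n, (u k ^ 8 + v k ^ 8) / 2) / n := by
  have hn0 : (0 : ℝ) < n := by exact_mod_cast hn
  have h2 := pow_sum_div_card_le_sum_pow (s := Finset.range n) (f := fun k => |u k * v k|)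
    (fun _ _ => abs_nonneg _) 3
  rw [Finset.card_range] at h2
  norm_num at h2
  have h3 : ∑ k ∈ Finset.range n, |u k * v k| ^ 4 ≤
      ∑ k ∈ Finset.range n, (u k ^ 8 + v k ^ 8) / 2 := by
    refine Finset.sum_le_sum fun k _ => ?_
    rw [← abs_pow, abs_of_nonneg (by positivity), mul_pow]
    nlinarith [sq_nonneg (u k ^ 4 - v k ^ 4)]
  have h4 : (∑ k ∈ Finset.range n, u k * v k) ^ 4 ≤ (∑ k ∈ Finset.range n, |u k * v k|) ^ 4 := by
    have e : (∑ k ∈ Finset.range n, u k * v k) ^ 4 = |∑ k ∈ Finset.range n, u k * v k| ^ 4 := by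
      rw [← abs_pow, abs_of_nonneg (by positivity)]
    rw [e]
    gcongr
    exact Finset.abs_sum_le_sum_abs _ _
  simp only [abs_mul] at h2 h3 h4
  rw [div_le_iff₀ (by positivity)] at h2
  rw [div_pow, div_le_div_iff₀ (by positivity) hn0]
  calc _ ≤ (∑ k ∈ Finset.range n, |u k| * |v k|) ^ 4 * n := by gcongr
    _ ≤ ((∑ k ∈ Finset.range n, (|u k| * |v k|) ^ 4) * n ^ 3) * n := by gcongr
    _ ≤ ((∑ k ∈ Finset.range n, (u k ^ 8 + v k ^ 8) / 2) * n ^ 3) * n := by gcongr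
    _ = _ := by ring

section

variable {Ω : Type*} [MeasurableSpace Ω] {P : Measure Ω}

theorem integral_pow_eight_le_of_lintegral {Y : Ω → ℝ} (hY : Measurable Y) {B : ℝ} (hB : 0 ≤ B)
    (h : ∫⁻ ω, ‖Y ω‖ₑ ^ 8 ∂P ≤ ENNReal.ofReal B) :
    Integrable (fun ω => Y ω ^ 8) P ∧ ∫ ω, Y ω ^ 8 ∂P ≤ B := by
  have e : ∀ ω, ‖Y ω‖ₑ ^ 8 = ENNReal.ofReal (Y ω ^ 8) := fun ω => by
    rw [← enorm_pow, Real.enorm_of_nonneg (by positivity)]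
  simp only [e] at h
  have hi : Integrable (fun ω => Y ω ^ 8) P := by
    refine ⟨(hY.pow_const 8).aestronglyMeasurable, ?_⟩
    rw [hasFiniteIntegral_iff_ofReal (ae_of_all _ fun ω => by positivity)]
    exact h.trans_lt ENNReal.ofReal_lt_top
  refine ⟨hi, ?_⟩
  rw [← ofReal_integral_eq_lintegral_ofReal hi (ae_of_all _ fun ω => by positivity)] at h
  exact (ENNReal.ofReal_le_ofReal_iff hB).1 h

theorem lintegral_pow_le_momentBound {X : ℕ → Ω → ℝ} {p : ℕ → ℝ → ℝ}
    (hβ : momentBound P X p < ∞) (k : ℕ) :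
    ∫⁻ ω, ‖X k ω‖ₑ ^ 8 ∂P ≤ ENNReal.ofReal (momentBound P X p).toReal ∧
    ∫⁻ ω, ‖steinKernel (p k) (X k ω)‖ₑ ^ 8 ∂P ≤ ENNReal.ofReal (momentBound P X p).toReal ∧
    ∫⁻ ω, ‖deriv (steinKernel (p k)) (X k ω)‖ₑ ^ 8 ∂P ≤
      ENNReal.ofReal (momentBound P X p).toReal := by
  rw [ENNReal.ofReal_toReal hβ.ne]
  unfold momentBound
  refine ⟨?_, ?_, ?_⟩
  · exact (le_iSup (fun k => ∫⁻ ω, ‖X k ω‖ₑ ^ 8 ∂P) k).trans (le_max_left _ _)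
  · exact (le_iSup (fun k => ∫⁻ ω, ‖steinKernel (p k) (X k ω)‖ₑ ^ 8 ∂P) k).trans
      ((le_max_left _ _).trans (le_max_right _ _))
  · exact (le_iSup (fun k => ∫⁻ ω, ‖deriv (steinKernel (p k)) (X k ω)‖ₑ ^ 8 ∂P) k).trans
      ((le_max_right _ _).trans (le_max_right _ _))

variable [IsProbabilityMeasure P]

namespace SteinSystem

variable {X : ℕ → Ω → ℝ} {p : ℕ → ℝ → ℝ}

theorem integral_kernel (h : SteinSystem P X p) {k : ℕ}
    (hτ : Integrable (fun ω => steinKernel (p k) (X k ω)) P) :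
    ∫ ω, steinKernel (p k) (X k ω) ∂P = ∫ ω, X k ω ^ 2 ∂P := by
  have m := h.measurable_steinKernel k
  have mX := (h.measurable k).aemeasurable (μ := P)
  have : IsProbabilityMeasure (P.map (X k)) := Measure.isProbabilityMeasure_map mX
  have := (h.dens k).integral_steinKernel (h.map_integrable k) (h.map_integrable_sq k)
    (h.map_mean k) ((integrable_map_measure m.aestronglyMeasurable mX).2 hτ)
  rwa [integral_map mX m.aestronglyMeasurable, integral_map mX (by fun_prop)] at this

/-- The Fisher information bound for a fixed number `n` of summands, in terms of bounds for the
eighth moments of the normalised quantities. -/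
theorem fisherDistance_le (h : SteinSystem P X p) {n : ℕ} (hn : 0 < n) {A B C D : ℝ}
    (hT : ∀ᵐ ω ∂P, ∑ j ∈ Finset.range n, steinKernel (p j) (X j ω) ≠ 0)
    (hA : Integrable (fun ω => ((∑ j ∈ Finset.range n, X j ω) / √n) ^ 8) P ∧
      ∫ ω, ((∑ j ∈ Finset.range n, X j ω) / √n) ^ 8 ∂P ≤ A)
    (hB : Integrable (fun ω =>
        ((∑ j ∈ Finset.range n, (steinKernel (p j) (X j ω) - 1)) / √n) ^ 8) P ∧
      ∫ ω, ((∑ j ∈ Finset.range n, (steinKernel (p j) (X j ω) - 1)) / √n) ^ 8 ∂P ≤ B)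
    (hC : Integrable (fun ω => (n / ∑ j ∈ Finset.range n, steinKernel (p j) (X j ω)) ^ 8) P ∧
      ∫ ω, (n / ∑ j ∈ Finset.range n, steinKernel (p j) (X j ω)) ^ 8 ∂P ≤ C)
    (hD : Integrable (fun ω => ((∑ k ∈ Finset.range n,
        steinKernel (p k) (X k ω) * deriv (steinKernel (p k)) (X k ω)) / n) ^ 4) P ∧
      ∫ ω, ((∑ k ∈ Finset.range n,
        steinKernel (p k) (X k ω) * deriv (steinKernel (p k)) (X k ω)) / n) ^ 4 ∂P ≤ D) :
    fisherDistance (P.map fun ω => (∑ k ∈ Finset.range n, X k ω) / √n) ≤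
      ENNReal.ofReal (2 * (3 + A + B + 2 * C + D) / n) := by
  have hn0 : (0 : ℝ) < n := by exact_mod_cast hn
  have hs0 : 0 < √(n : ℝ) := Real.sqrt_pos.2 hn0
  have hss : √(n : ℝ) ^ 2 = n := Real.sq_sqrt hn0.le
  have mS := h.measurable_sum (Finset.range n)
  have mT := h.measurable_kernel_sum (Finset.range n)
  have mR := h.measurable_kernel_deriv_sum (Finset.range n)
  have ibp := fun (φ φ' : ℝ → ℝ) (M : ℝ) hST hRT hφ hφ'c hφM hφ'M =>
    h.integral_deriv_eq (φ := φ) (φ' := φ') (M := M) (c := (√(n : ℝ))⁻¹) (Finset.range n) hT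
      hST hRT hφ hφ'c hφM hφ'M (by positivity)
  have hsub : ∀ ω, ∑ j ∈ Finset.range n, (steinKernel (p j) (X j ω) - 1) =
      (∑ j ∈ Finset.range n, steinKernel (p j) (X j ω)) - n := fun ω => by simp
  simp only [hsub] at hB
  have hXi : Integrable (fun ω => (∑ k ∈ Finset.range n, X k ω) / √n) P :=
    (integrable_finsetSum _ fun k _ => h.integrable k).div_const _
  set S : Ω → ℝ := fun ω => ∑ j ∈ Finset.range n, X j ω with hS
  set T : Ω → ℝ := fun ω => ∑ j ∈ Finset.range n, steinKernel (p j) (X j ω) with hTdef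
  set R : Ω → ℝ := fun ω => ∑ k ∈ Finset.range n,
    steinKernel (p k) (X k ω) * deriv (steinKernel (p k)) (X k ω) with hR
  change ∀ᵐ ω ∂P, T ω ≠ 0 at hT
  change Integrable (fun ω => (S ω / √n) ^ 8) P ∧ ∫ ω, (S ω / √n) ^ 8 ∂P ≤ A at hA
  change Integrable (fun ω => ((T ω - n) / √n) ^ 8) P ∧ ∫ ω, ((T ω - n) / √n) ^ 8 ∂P ≤ B at hB
  change Integrable (fun ω => (n / T ω) ^ 8) P ∧ ∫ ω, (n / T ω) ^ 8 ∂P ≤ C at hC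
  change Integrable (fun ω => (R ω / n) ^ 4) P ∧ ∫ ω, (R ω / n) ^ 4 ∂P ≤ D at hD
  change Integrable (fun ω => S ω / √n) P at hXi
  have h2 : ∀ x : ℝ, x ^ 2 ≤ 1 + x ^ 8 := fun x => by
    have := abs_pow_le_one_add_pow_eight x (j := 2) (by norm_num)
    rwa [← abs_pow, abs_of_nonneg (by positivity)] at this
  have hST : Integrable (fun ω => S ω / T ω) P := by
    refine ((((integrable_const (1 : ℝ)).add hA.1).add ((integrable_const (1 : ℝ)).add hC.1)).div_const
      √(n : ℝ)).mono' (mS.div mT).aestronglyMeasurable (ae_of_all _ fun ω => ?_)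
    have e : S ω / T ω = (S ω / √n) * (n / T ω) / √n := by
      nth_rewrite 2 [← hss]
      field_simp
    rw [e, norm_div, Real.norm_eq_abs, Real.norm_eq_abs, abs_of_pos hs0, abs_mul]
    refine div_le_div_of_nonneg_right ?_ hs0.le
    have ha := h2 (S ω / √n)
    have hc := h2 (n / T ω)
    rw [← sq_abs] at ha hc
    simp only [Pi.add_apply]
    nlinarith [sq_nonneg (|S ω / √n| - |n / T ω|)]
  have hRT : Integrable (fun ω => R ω / T ω ^ 2) P := by
    refine ((((integrable_const (1 : ℝ)).add hD.1).add hC.1).div_const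
      (n : ℝ)).mono' (mR.div (mT.pow_const 2)).aestronglyMeasurable (ae_of_all _ fun ω => ?_)
    have e : R ω / T ω ^ 2 = (R ω / n) * (n / T ω) ^ 2 / n := by
      field_simp
    rw [e, norm_div, Real.norm_eq_abs, Real.norm_eq_abs, abs_of_pos hn0, abs_mul]
    refine div_le_div_of_nonneg_right ?_ hn0.le
    simp only [Pi.add_apply]
    generalize n / T ω = c
    generalize R ω / n = d
    rw [abs_of_nonneg (sq_nonneg c)]
    have : |d| * c ^ 2 ≤ |d| ^ 2 / 2 + c ^ 4 / 2 := by nlinarith [sq_nonneg (|d| - c ^ 2)]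
    rw [sq_abs] at this
    nlinarith [sq_nonneg (d ^ 2 - 1), sq_nonneg (c ^ 4 - 1), sq_nonneg (d ^ 2), sq_nonneg (c ^ 4)]
  have hW : Integrable (fun ω => √n * (S ω / T ω + R ω / T ω ^ 2)) P :=
    (hST.add hRT).const_mul _
  refine (fisherDistance_map_le (mS.div_const _) hXi hW ?_).trans ?_
  · intro φ φ' M hφ hφ'c hφM hφ'M
    have h1 := ibp φ φ' M hST hRT hφ hφ'c hφM hφ'M
    change (√(n : ℝ))⁻¹ * ∫ ω, φ' ((√(n : ℝ))⁻¹ * S ω) ∂P =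
      ∫ ω, φ ((√(n : ℝ))⁻¹ * S ω) * (S ω / T ω + R ω / T ω ^ 2) ∂P at h1
    rw [inv_mul_eq_iff_eq_mul₀ hs0.ne', ← integral_const_mul] at h1
    simp only [inv_mul_eq_div] at h1
    refine h1.trans (integral_congr_ae (ae_of_all _ fun ω => ?_))
    change _ * (_ * _) = _ * (_ * _)
    ring
  · set G : Ω → ℝ := fun ω => 2 * (3 + (S ω / √n) ^ 8 + ((T ω - n) / √n) ^ 8 +
      2 * (n / T ω) ^ 8 + (R ω / n) ^ 4) / n with hG
    have i1 : Integrable (fun ω => 3 + (S ω / √n) ^ 8) P := (integrable_const _).add hA.1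
    have i2 : Integrable (fun ω => 3 + (S ω / √n) ^ 8 + ((T ω - n) / √n) ^ 8) P := i1.add hB.1
    have i3 : Integrable (fun ω => 3 + (S ω / √n) ^ 8 + ((T ω - n) / √n) ^ 8 +
      2 * (n / T ω) ^ 8) P := i2.add (hC.1.const_mul 2)
    have i4 : Integrable (fun ω => 3 + (S ω / √n) ^ 8 + ((T ω - n) / √n) ^ 8 +
      2 * (n / T ω) ^ 8 + (R ω / n) ^ 4) P := i3.add hD.1
    have hGi : Integrable G P := (i4.const_mul 2).div_const _
    calc _ ≤ ∫⁻ ω, ENNReal.ofReal (G ω) ∂P := by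
          refine lintegral_mono_ae ?_
          filter_upwards [hT] with ω hω
          refine ENNReal.ofReal_le_ofReal ?_
          have e : √n * (S ω / T ω + R ω / T ω ^ 2) - S ω / √n =
              (-((S ω / √n) * ((T ω - n) / √n) * (n / T ω)) + R ω / n * (n / T ω) ^ 2) / √n := by
            field_simp
            rw [hss]
            ring
          rw [e, div_pow, hss, hG]
          exact div_le_div_of_nonneg_right (sq_sub_le_of_pow_eight _ _ _ _) hn0.le
      _ = ENNReal.ofReal (∫ ω, G ω ∂P) := by
          refine (ofReal_integral_eq_lintegral_ofReal hGi (ae_of_all _ fun ω => ?_)).symm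
          simp only [hG]; positivity
      _ ≤ _ := by
          refine ENNReal.ofReal_le_ofReal ?_
          rw [hG, integral_div, integral_const_mul, integral_add i3 hD.1,
            integral_add i2 (hC.1.const_mul 2), integral_add i1 hB.1,
            integral_add (integrable_const _) hA.1, integral_const_mul]
          simp only [integral_const, probReal_univ, smul_eq_mul, one_mul]
          refine div_le_div_of_nonneg_right ?_ hn0.le
          have := hA.2
          have := hB.2
          have := hC.2
          have := hD.2
          linarith

end SteinSystem

end

section

variable {Ω : Type*} [MeasurableSpace Ω] {P : Measure Ω}
  {X : ℕ → Ω → ℝ} {p : ℕ → ℝ → ℝ}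

theorem steinSystem_of_momentBound_lt_top [IsProbabilityMeasure P]
    (hX : ∀ k, Measurable (X k)) (hi : iIndepFun X P)
    (hm : ∀ k, ∫ ω, X k ω ∂P = 0) (hp : ∀ k, HasIntervalDensity (P.map (X k)) (p k))
    (hβ : momentBound P X p < ∞) : SteinSystem P X p := by
  have h8 := fun k => (integral_pow_eight_le_of_lintegral (hX k) ENNReal.toReal_nonneg
    (lintegral_pow_le_momentBound hβ k).1).1
  have d8 := fun k => (integral_pow_eight_le_of_lintegral
    ((measurable_deriv (steinKernel (p k))).comp (hX k)) ENNReal.toReal_nonneg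
    (lintegral_pow_le_momentBound hβ k).2.2).1
  refine ⟨hX, hi, hp, fun k => ?_, fun k => integrable_pow_of_pow_eight (hX k) (h8 k) (by norm_num),
    hm, fun k => ?_⟩
  · simpa using integrable_pow_of_pow_eight (hX k) (h8 k) (j := 1) (by norm_num)
  · simpa using integrable_pow_of_pow_eight ((measurable_deriv (steinKernel (p k))).comp (hX k))
      (d8 k) (j := 1) (by norm_num)

theorem integral_div_sqrt_pow_eight_le {Y : Ω → ℝ} {K : ℝ} {n : ℕ} (hn : 0 < n)
    (hY : Integrable (fun ω => Y ω ^ 8) P ∧ ∫ ω, Y ω ^ 8 ∂P ≤ K * (n : ℝ) ^ 4) :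
    Integrable (fun ω => (Y ω / √n) ^ 8) P ∧ ∫ ω, (Y ω / √n) ^ 8 ∂P ≤ K := by
  have hn0 : (0 : ℝ) < n := by exact_mod_cast hn
  have e : ∀ ω, (Y ω / √n) ^ 8 = Y ω ^ 8 / (n : ℝ) ^ 4 := fun ω => by
    rw [div_pow]
    congr 1
    calc √(n : ℝ) ^ 8 = (√(n : ℝ) ^ 2) ^ 4 := by ring
      _ = _ := by rw [Real.sq_sqrt hn0.le]
  simp only [e]
  refine ⟨hY.1.div_const _, ?_⟩
  rw [integral_div, div_le_iff₀ (by positivity)]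
  exact hY.2

theorem ae_ne_zero_of_lintegral_inv_lt_top {T : Ω → ℝ} (hT : Measurable T)
    (h : ∫⁻ ω, (‖T ω‖ₑ ^ 8)⁻¹ ∂P < ∞) : ∀ᵐ ω ∂P, T ω ≠ 0 := by
  filter_upwards [ae_lt_top (by fun_prop) h.ne] with ω hω h0
  simp [h0] at hω

theorem lintegral_div_pow_eight {T : Ω → ℝ} {n : ℕ} (h0 : ∀ᵐ ω ∂P, T ω ≠ 0) (hT : Measurable T) :
    ∫⁻ ω, ‖(n : ℝ) / T ω‖ₑ ^ 8 ∂P = (n : ℝ≥0∞) ^ 8 * ∫⁻ ω, (‖T ω‖ₑ ^ 8)⁻¹ ∂P := by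
  rw [← lintegral_const_mul _ (by fun_prop)]
  refine lintegral_congr_ae ?_
  filter_upwards [h0] with ω hω
  rw [div_eq_mul_inv, enorm_mul, enorm_inv hω, mul_pow, ENNReal.inv_pow]
  simp

namespace SteinSystem

theorem integral_mean_mul_deriv_pow_four_le (h : SteinSystem P X p) {b : ℝ}
    (hτ : ∀ k, Integrable (fun ω => steinKernel (p k) (X k ω) ^ 8) P ∧
      ∫ ω, steinKernel (p k) (X k ω) ^ 8 ∂P ≤ b)
    (hd : ∀ k, Integrable (fun ω => deriv (steinKernel (p k)) (X k ω) ^ 8) P ∧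
      ∫ ω, deriv (steinKernel (p k)) (X k ω) ^ 8 ∂P ≤ b) {n : ℕ} (hn : 0 < n) :
    Integrable (fun ω => ((∑ k ∈ Finset.range n,
        steinKernel (p k) (X k ω) * deriv (steinKernel (p k)) (X k ω)) / n) ^ 4) P ∧
      ∫ ω, ((∑ k ∈ Finset.range n,
        steinKernel (p k) (X k ω) * deriv (steinKernel (p k)) (X k ω)) / n) ^ 4 ∂P ≤ b := by
  have hn0 : (0 : ℝ) < n := by exact_mod_cast hn
  have hint : ∀ k ∈ Finset.range n, Integrable (fun ω => (steinKernel (p k) (X k ω) ^ 8 +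
      deriv (steinKernel (p k)) (X k ω) ^ 8) / 2) P := fun k _ =>
    ((hτ k).1.add (hd k).1).div_const 2
  have hdom := (integrable_finsetSum _ hint).div_const (n : ℝ)
  have hle : ∀ ω, ((∑ k ∈ Finset.range n,
      steinKernel (p k) (X k ω) * deriv (steinKernel (p k)) (X k ω)) / n) ^ 4 ≤
      (∑ k ∈ Finset.range n, (steinKernel (p k) (X k ω) ^ 8 +
      deriv (steinKernel (p k)) (X k ω) ^ 8) / 2) / n := fun ω => mean_mul_pow_four_le hn _ _
  have hi : Integrable (fun ω => ((∑ k ∈ Finset.range n,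
      steinKernel (p k) (X k ω) * deriv (steinKernel (p k)) (X k ω)) / n) ^ 4) P := by
    refine hdom.mono' (((h.measurable_kernel_deriv_sum _).div_const _).pow_const
      4).aestronglyMeasurable (ae_of_all _ fun ω => ?_)
    rw [Real.norm_eq_abs, abs_of_nonneg (by positivity)]
    exact hle ω
  refine ⟨hi, (integral_mono hi hdom hle).trans ?_⟩
  rw [integral_div, integral_finsetSum _ hint, div_le_iff₀ hn0]
  calc _ ≤ ∑ k ∈ Finset.range n, b := by
        refine Finset.sum_le_sum fun k _ => ?_
        rw [integral_div, integral_add (hτ k).1 (hd k).1]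
        have := (hτ k).2
        have := (hd k).2
        linarith
    _ = b * n := by simp [mul_comm]

end SteinSystem

end

theorem corollary4p3 :
    ∃ C : ℝ → ℝ → ℝ, (∀ β γ : ℝ, 0 < C β γ) ∧
      ∀ {Ω : Type*} [MeasurableSpace Ω] (P : Measure Ω) [IsProbabilityMeasure P]
        (X : ℕ → Ω → ℝ) (p : ℕ → ℝ → ℝ),
        (∀ k, Measurable (X k)) →
        iIndepFun X P →
        (∀ k, ∫ ω, X k ω ∂P = 0) →
        (∀ k, variance (X k) P = 1) →
        (∀ k, HasIntervalDensity (P.map (X k)) (p k)) →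
        momentBound P X p < ∞ →
        ∀ n₀ : ℕ, 1 ≤ n₀ → negMoment P X p n₀ < ∞ →
          negMomentSup P X p n₀ < ∞ ∧
          ∀ n : ℕ, n₀ ≤ n →
            fisherDistance
                (P.map fun ω => (∑ k ∈ Finset.range n, X k ω) / Real.sqrt (n : ℝ)) ≤
              ENNReal.ofReal
                (C (momentBound P X p).toReal (negMomentSup P X p n₀).toReal / (n : ℝ)) := by
  refine ⟨fun β γ => 2 * (3 + ((247 * (1 + |β|)) ^ 4 + 247 * |β|) +
    ((247 * (1 + 128 * (|β| + 1))) ^ 4 + 247 * (128 * (|β| + 1))) + 2 * |γ| + |β|),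
    fun β γ => by positivity, ?_⟩
  intro Ω _ P _ X p hX hi hm hv hp hβ n₀ hn₀ hneg
  have hsys := steinSystem_of_momentBound_lt_top hX hi hm hp hβ
  have hb0 : 0 ≤ (momentBound P X p).toReal := ENNReal.toReal_nonneg
  have hX8 := fun k => integral_pow_eight_le_of_lintegral (hX k) hb0
    (lintegral_pow_le_momentBound hβ k).1
  have hτ8 := fun k => integral_pow_eight_le_of_lintegral (hsys.measurable_kernel k) hb0
    (lintegral_pow_le_momentBound hβ k).2.1
  have hd8 := fun k => integral_pow_eight_le_of_lintegral (hsys.measurable_deriv_kernel k) hb0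
    (lintegral_pow_le_momentBound hβ k).2.2
  generalize (momentBound P X p).toReal = b at *
  have hτi : ∀ k, Integrable (fun ω => steinKernel (p k) (X k ω)) P := fun k => by
    simpa using integrable_pow_of_pow_eight (hsys.measurable_kernel k) (hτ8 k).1 (j := 1)
      (by norm_num)
  have hτ2 : ∀ k, Integrable (fun ω => steinKernel (p k) (X k ω) ^ 2) P := fun k =>
    integrable_pow_of_pow_eight (hsys.measurable_kernel k) (hτ8 k).1 (by norm_num)
  have hτ1 : ∀ k, ∫ ω, steinKernel (p k) (X k ω) ∂P = 1 := fun k => by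
    rw [hsys.integral_kernel (hτi k)]
    have := hv k
    rw [variance_eq_integral (hX k).aemeasurable, hm k] at this
    simpa using this
  have hτind : iIndepFun (fun k ω => steinKernel (p k) (X k ω)) P :=
    hi.comp (fun k => steinKernel (p k)) fun k => hsys.measurable_steinKernel k
  have hγ : negMomentSup P X p n₀ < ∞ :=
    iSup_negative_moment_lt_top (b := 1 + b) (by positivity) hτind hsys.measurable_kernel
      (fun k ω => hsys.steinKernel_nonneg k _) hτi hτ2 hτ1
      (fun k => (integral_sq_le_one_add (hsys.measurable_kernel k) (hτ8 k).1).trans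
        (by linarith [(hτ8 k).2])) hneg
  refine ⟨hγ, fun n hn => ?_⟩
  have hn1 : 0 < n := by omega
  have hnT : (n : ℝ≥0∞) ^ 8 * negMoment P X p n ≤ negMomentSup P X p n₀ :=
    le_iSup₂ (f := fun (n : ℕ) (_ : n ≥ n₀) => (n : ℝ≥0∞) ^ 8 * negMoment P X p n) n hn
  have hTfin : negMoment P X p n < ∞ := by
    by_contra hc
    rw [not_lt, top_le_iff] at hc
    rw [hc, ENNReal.mul_top (by positivity)] at hnT
    exact absurd hγ (not_lt.2 hnT)
  have hT0 := ae_ne_zero_of_lintegral_inv_lt_top (hsys.measurable_kernel_sum (Finset.range n)) hTfin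
  have hC := integral_pow_eight_le_of_lintegral (P := P)
    (Y := fun ω => (n : ℝ) / ∑ j ∈ Finset.range n, steinKernel (p j) (X j ω))
    (measurable_const.div (hsys.measurable_kernel_sum _))
    (ENNReal.toReal_nonneg (a := negMomentSup P X p n₀)) (by
      rw [lintegral_div_pow_eight hT0 (hsys.measurable_kernel_sum _), ENNReal.ofReal_toReal hγ.ne]
      exact hnT)
  have hA := integral_div_sqrt_pow_eight_le hn1 (integral_sum_pow_eight_le hX hi
    (fun k => (hX8 k).1) hm (fun k => (hX8 k).2) n)
  have hY8i : ∀ k, Integrable (fun ω => 128 * (steinKernel (p k) (X k ω) ^ 8 + 1)) P := fun k =>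
    ((hτ8 k).1.add (integrable_const _)).const_mul 128
  have hY8 : ∀ k, Integrable (fun ω => (steinKernel (p k) (X k ω) - 1) ^ 8) P := fun k => by
    refine (hY8i k).mono' (((hsys.measurable_kernel k).sub_const 1).pow_const
      8).aestronglyMeasurable (ae_of_all _ fun ω => ?_)
    rw [Real.norm_eq_abs, abs_of_nonneg (by positivity)]
    exact sub_one_pow_eight_le _
  have hB := integral_div_sqrt_pow_eight_le hn1 (integral_sum_pow_eight_le (B := 128 * (b + 1))
    (fun k => (hsys.measurable_kernel k).sub_const 1)
    (hτind.comp (fun _ x => x - 1) fun _ => measurable_id.sub_const 1) hY8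
    (fun k => by rw [integral_sub (hτi k) (integrable_const _), hτ1 k]; simp)
    (fun k => by
      refine (integral_mono (hY8 k) (hY8i k) fun ω => sub_one_pow_eight_le _).trans ?_
      rw [integral_const_mul, integral_add (hτ8 k).1 (integrable_const _)]
      simp only [integral_const, probReal_univ, smul_eq_mul, one_mul]
      linarith [(hτ8 k).2]) n)
  have hD := hsys.integral_mean_mul_deriv_pow_four_le hτ8 hd8 hn1
  have := hsys.fisherDistance_le hn1 hT0 hA hB hC hD
  simpa only [abs_of_nonneg hb0,
    abs_of_nonneg (ENNReal.toReal_nonneg (a := negMomentSup P X p n₀))] using this
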